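/- Let $L$ be the first-order language of a (possibly many-sorted) signature with equality, let $|L|$ be the number of $L$-formulas, and let $T$ be a complete (that is, maximal satisfiable) $L$-theory. Let $x$ be a tuple of variables. For a model $M\models T$ let $\mathrm{Def}_x(M)$ be the Boolean algebra of subsets of $M_x$ definable in $M$ with parameters ($M_x$ is the set of tuples from $M$ of the sorts of $x$). A *$\bigvee$-definable ideal schema* $I$ for $T$ in the context $x$ assigns to every partitioned formula $\psi(x,z)$, with arbitrary parameter variables $z$, a set $\neg Ix.\psi(x,z)$ of formulas whose free variables are among the free variables of $\psi$ not in $x$, such that for every $M\models T$: (1) whenever $\psi(x,c)$ and $\theta(x,d)$ define the same subset of $M_x$, the tuple $c$ satisfies all of $\neg Ix.\psi(x,z)$ in $M$ if and only if $d$ satisfies all of $\neg Ix.\theta(x,z')$ in $M$; and (2) the collection $I(M)$ of the sets $\psi(M,c)$ for which $c$ does not satisfy all of $\neg Ix.\psi(x,z)$ is a proper ideal of $\mathrm{Def}_x(M)$. Fix such an $I$. Let $\varphi(x,y)$ be a partitioned $L$-formula, with $y$ a finite tuple, and write $\varphi^1=\varphi$, $\varphi^0=\neg\varphi$. * For $A\subseteq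 M\models T$, a *complete $\varphi$-type* over $A$ is a set of finite Boolean combinations of formulas $\varphi(x,a)$, $a$ a tuple from $A$, that is maximal among such sets satisfiable together with the $L(A)$-theory of $M$. It is *wide* if none of its members defines a set in $I(M)$. $S^I_\varphi(A,M)$ is the set of wide complete $\varphi$-types over $A$. * A type $p(x)$ over $M$ is *definable over $M$* if for every formula $\chi(x,z)$ there is a formula $\psi(z)$ with parameters in $M$ such that, for all $c\in M_z$, $\chi(x,c)\in p$ implies $M\models\psi(c)$, and $\neg\chi(x,c)\in p$ implies $M\models\neg\psi(c)$. * $\mathrm{Tree}[I,\varphi,\omega]$ is the union, over $\sigma\in 2^\omega$ and finite $K\subset\omega$, of the sets $\neg Ix.\bigl(x=x\wedge\bigwedge_{n\in K}\varphi(x,y_{\sigma\restriction n})^{\sigma(n)}\bigr)$, in the free variables $(y_s : s\in 2^{<\omega})$. * For $M\models T$ and $\psi(x)$ with parameters in $M$: $R^{I(M)}(\psi,\varphi,2)\ge 0$ iff $\psi(M)\notin I(M)$, and $R^{I(M)}(\psi,\varphi,2)\ge n+1$ iff there is $c\in M_y$ such that $R^{I(M)}(\psi\wedge\varphi(x,c)^t,\varphi,2)\ge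 n$ for both $t\in\{0,1\}$. The rank is $-\infty$ if $\psi(M)\in I(M)$, $+\infty$ if it is $\ge n$ for every $n\in\omega$, and otherwise the largest $n$ such that it is $\ge n$. $R^I(T,\varphi,2)$ denotes $R^{I(M)}(x=x,\varphi,2)$ for any $\omega$-saturated $M\models T$. Then the following are equivalent. (a) For every cardinal $\lambda\ge 2^{|L|}$, every $M\models T$ and every $A\subseteq M$ with $|A|\le\lambda$, $|S^I_\varphi(A,M)|\le\lambda$. (b) There is a cardinal $\lambda\ge\aleph_0$ such that for every $M\models T$ and every $A\subseteq M$ with $|A|\le\lambda$, $|S^I_\varphi(A,M)|\le\lambda$. (c) $\mathrm{Tree}[I,\varphi,\omega]$ is inconsistent with $T$: it is not realized in any model of $T$. (d) $R^I(T,\varphi,2)<\infty$ (for every, equivalently for some, choice of the $\omega$-saturated model of $T$ in which the rank is computed). (e) For every $\omega$-saturated model $M\models T$, every wide complete $\varphi$-type $p\in S^I_\varphi(M,M)$ is definable over $M$. -/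

import Mathlib

universe u

namespace ManySorted

/-! ### Many-sorted first-order logic -/

/-- A many-sorted signature: sorts, function symbols `s₁ × ⋯ × sₙ → s` and relation symbols on
`s₁ × ⋯ × sₙ`. Equality on every sort is a logical symbol. -/
structure Language where
  Sorts : Type u
  Functions : List Sorts → Sorts → Type u
  Relations : List Sorts → Type u

/-- A tuple of variables (a context) is a family `V : S → Type u`, where `V s` is the set of
variables of sort `s`. `join V W` is the concatenation of two disjoint contexts. -/
abbrev join {S : Type u} (V W : S → Type u) : S → Type u := fun s => V s ⊕ W s

/-- The tuples indexed by the context `V` with components, of the appropriate sorts, in `M`;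
for the universe `M` of a structure this is `M_V`. -/
abbrev Tuple {S : Type u} (V M : S → Type u) : Type u := ∀ s, V s → M s

/-- Concatenation of tuples. -/
def Tuple.append {S : Type u} {V W M : S → Type u} (a : Tuple V M) (b : Tuple W M) :
    Tuple (join V W) M := fun s => Sum.elim (a s) (b s)

/-- De Bruijn variables: `BVar l s` is the set of occurrences of the sort `s` in the list `l`. -/
inductive BVar {S : Type u} : List S → S → Type u
  | zero {l : List S} {s : S} : BVar (s :: l) s
  | succ {l : List S} {s t : S} : BVar l t → BVar (s :: l) t

/-- Terms of a given sort, with variables in `V`. -/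
inductive Term (L : Language.{u}) (V : L.Sorts → Type u) : L.Sorts → Type u
  | var {s : L.Sorts} : V s → Term L V s
  | app {l : List L.Sorts} {s : L.Sorts} :
      L.Functions l s → (∀ i : Fin l.length, Term L V (l.get i)) → Term L V s

/-- Formulas with free variables in `V` and further variables in the list `l`, the latter waiting
to be bound. -/
inductive BFormula (L : Language.{u}) (V : L.Sorts → Type u) : List L.Sorts → Type u
  | falsum {l : List L.Sorts} : BFormula L V l
  | equal {l : List L.Sorts} {s : L.Sorts} :
      Term L (join V (BVar l)) s → Term L (join V (BVar l)) s → BFormula L V l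
  | rel {l m : List L.Sorts} :
      L.Relations m → (∀ i : Fin m.length, Term L (join V (BVar l)) (m.get i)) → BFormula L V l
  | imp {l : List L.Sorts} : BFormula L V l → BFormula L V l → BFormula L V l
  | all {l : List L.Sorts} (s : L.Sorts) : BFormula L V (s :: l) → BFormula L V l

/-- `L`-formulas whose free variables are in the context `V`. -/
abbrev Formula (L : Language.{u}) (V : L.Sorts → Type u) : Type u := BFormula L V []

/-- `L`-sentences. -/
abbrev Sentence (L : Language.{u}) : Type u := Formula L (fun _ => PEmpty)

/-- The cardinality `|L|`: the number of `L`-formulas, where every sort has countably many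
variables. -/
noncomputable def Language.card (L : Language.{u}) : Cardinal.{u} :=
  Cardinal.mk (Formula L (fun _ => ULift ℕ))

/-! ### Syntax -/

namespace Term

variable {L : Language.{u}} {V W : L.Sorts → Type u}

/-- Renaming of variables. -/
def relabel (g : ∀ s, V s → W s) : ∀ {s : L.Sorts}, Term L V s → Term L W s
  | _, var v => var (g _ v)
  | _, app f ts => app f (fun i => (ts i).relabel g)

/-- The set of variables occurring in a term. -/
def vars : ∀ {s : L.Sorts}, Term L V s → Set (Σ s, V s)
  | _, var v => {⟨_, v⟩}
  | _, app _ ts => ⋃ i, (ts i).vars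

end Term

namespace BFormula

variable {L : Language.{u}} {V W : L.Sorts → Type u}

/-- Renaming of free variables. -/
def relabel (g : ∀ s, V s → W s) : ∀ {l : List L.Sorts}, BFormula L V l → BFormula L W l
  | _, falsum => falsum
  | _, equal t₁ t₂ =>
      equal (t₁.relabel (fun s => Sum.map (g s) id)) (t₂.relabel (fun s => Sum.map (g s) id))
  | _, rel R ts => rel R (fun i => (ts i).relabel (fun s => Sum.map (g s) id))
  | _, imp ψ θ => imp (ψ.relabel g) (θ.relabel g)
  | _, all s ψ => all s (ψ.relabel g)

/-- The set of free variables of a formula. -/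
def fv : ∀ {l : List L.Sorts}, BFormula L V l → Set (Σ s, V s)
  | _, falsum => ∅
  | _, equal t₁ t₂ => {v | ⟨v.1, Sum.inl v.2⟩ ∈ t₁.vars ∪ t₂.vars}
  | _, rel _ ts => {v | ∃ i, ⟨v.1, Sum.inl v.2⟩ ∈ (ts i).vars}
  | _, imp ψ θ => ψ.fv ∪ θ.fv
  | _, all _ ψ => ψ.fv

variable {l : List L.Sorts}

/-- Negation. -/
def neg (ψ : BFormula L V l) : BFormula L V l := imp ψ falsum

/-- The true formula; in context `x` it plays the role of `x = x`. -/
def verum : BFormula L V l := neg falsum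

/-- Conjunction. -/
def conj (ψ θ : BFormula L V l) : BFormula L V l := neg (imp ψ (neg θ))

/-- Conjunction of a finite list of formulas. -/
def bigConj (ψs : List (BFormula L V l)) : BFormula L V l := ψs.foldr conj verum

/-- `ψ ^ t`, that is `ψ` if `t = 1` and `¬ψ` if `t = 0`. -/
def pow (ψ : BFormula L V l) (t : Bool) : BFormula L V l := if t then ψ else neg ψ

end BFormula

/-! ### Semantics -/

/-- `L`-structures; all sorts are nonempty. -/
structure Struct (L : Language.{u}) where
  carrier : L.Sorts → Type u
  nonempty : ∀ s, Nonempty (carrier s)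
  funMap : ∀ {l : List L.Sorts} {s : L.Sorts},
    L.Functions l s → (∀ i : Fin l.length, carrier (l.get i)) → carrier s
  relMap : ∀ {l : List L.Sorts},
    L.Relations l → (∀ i : Fin l.length, carrier (l.get i)) → Prop

variable {L : Language.{u}}

/-- The value of a term. -/
def Term.eval (M : Struct L) {V : L.Sorts → Type u} (a : Tuple V M.carrier) :
    ∀ {s : L.Sorts}, Term L V s → M.carrier s
  | _, .var v => a _ v
  | _, .app f ts => M.funMap f (fun i => (ts i).eval M a)

/-- Adding the value of one more bound variable. -/
def BVar.cons {S : Type u} {M : S → Type u} {l : List S} {s : S} (m : M s)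
    (b : Tuple (BVar l) M) : Tuple (BVar (s :: l)) M
  | _, .zero => m
  | _, .succ v => b _ v

/-- The assignment to the empty list of bound variables. -/
def BVar.nil {S : Type u} {M : S → Type u} : Tuple (BVar ([] : List S)) M :=
  fun _ v => nomatch v

/-- Satisfaction, for formulas with bound variables. -/
def BFormula.Holds (M : Struct L) {V : L.Sorts → Type u} (a : Tuple V M.carrier) :
    ∀ {l : List L.Sorts}, BFormula L V l → Tuple (BVar l) M.carrier → Prop
  | _, .falsum, _ => False
  | _, .equal t₁ t₂, b => t₁.eval M (a.append b) = t₂.eval M (a.append b)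
  | _, .rel R ts, b => M.relMap R (fun i => (ts i).eval M (a.append b))
  | _, .imp ψ θ, b => ψ.Holds M a b → θ.Holds M a b
  | _, .all s ψ, b => ∀ m : M.carrier s, ψ.Holds M a (BVar.cons m b)

/-- `M ⊨ ψ(a)`. -/
def Struct.Sat (M : Struct L) {V : L.Sorts → Type u} (ψ : Formula L V) (a : Tuple V M.carrier) :
    Prop := ψ.Holds M a BVar.nil

/-- `M ⊨ T`, for a set `T` of sentences. -/
def Struct.Models (M : Struct L) (T : Set (Sentence L)) : Prop :=
  ∀ χ ∈ T, M.Sat χ (fun _ v => nomatch v)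

/-- A theory is complete if it is maximal among the satisfiable theories. -/
def IsComplete (T : Set (Sentence L)) : Prop :=
  Maximal (fun T' : Set (Sentence L) => ∃ M : Struct L, M.Models T') T

/-- The set `ψ(M, c) ⊆ M_x` defined by `ψ(x, c)`, for `ψ(x, y)` and `c ∈ M_y`. -/
def Struct.points (M : Struct L) {x Y : L.Sorts → Type u} (ψ : Formula L (join x Y))
    (c : Tuple Y M.carrier) : Set (Tuple x M.carrier) := {a | M.Sat ψ (a.append c)}

/-- The algebra of the subsets of `M_x` definable in `M` with parameters. -/
def Struct.Def (M : Struct L) (x : L.Sorts → Type u) : Set (Set (Tuple x M.carrier)) :=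
  {D | ∃ (Y : L.Sorts → Type u) (ψ : Formula L (join x Y)) (c : Tuple Y M.carrier),
    M.points ψ c = D}

/-- Sets of parameters of `M`. -/
abbrev Struct.Params (M : Struct L) : Type u := ∀ s, Set (M.carrier s)

/-- The elements of a parameter set, as a context. An `L(A)`-formula with free variables in `z` is
represented by an `L`-formula in the context `join z A.ctx`, the variables in `A.ctx` being the
constants naming the elements of `A`. -/
abbrev Struct.Params.ctx {M : Struct L} (A : M.Params) : L.Sorts → Type u := fun s => A s

/-- The tuple of all elements of `A`, each named by itself. -/
def Struct.Params.incl {M : Struct L} (A : M.Params) : Tuple A.ctx M.carrier := fun _ a => a.1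

/-- The cardinality of a parameter set. -/
noncomputable def Struct.Params.card {M : Struct L} (A : M.Params) : Cardinal.{u} :=
  Cardinal.mk (Σ s, A s)

/-- The set of all elements of `M`. -/
def Struct.allParams (M : Struct L) : M.Params := fun _ => Set.univ

/-- `p(z)`, a set of `L(A)`-formulas, is a partial type over `A` with respect to `M`: it is
satisfiable together with the `L(A)`-theory of `M`. -/
def Struct.IsPartialType (M : Struct L) (A : M.Params) {z : L.Sorts → Type u}
    (p : Set (Formula L (join z A.ctx))) : Prop :=
  ∃ (N : Struct L) (f : Tuple A.ctx N.carrier),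
    (∀ χ : Formula L A.ctx, M.Sat χ A.incl → N.Sat χ f) ∧
    ∃ c : Tuple z N.carrier, ∀ ψ ∈ p, N.Sat ψ (c.append f)

/-- `M` is `ω`-saturated: every partial type in finitely many variables over a finite set of
parameters is realized in `M`. -/
def Struct.OmegaSaturated (M : Struct L) : Prop :=
  ∀ A : M.Params, Finite (Σ s, A s) → ∀ z : L.Sorts → Type u, Finite (Σ s, z s) →
    ∀ p : Set (Formula L (join z A.ctx)), M.IsPartialType A p →
      ∃ c : Tuple z M.carrier, ∀ ψ ∈ p, M.Sat ψ (c.append A.incl)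

/-- `φ(x, a)`, for `φ(x, y)` and a tuple `a` of parameters, or of other variables, in `Z`. -/
def BFormula.inst {x y Z : L.Sorts → Type u} (φ : Formula L (join x y)) (a : Tuple y Z) :
    Formula L (join x Z) :=
  φ.relabel (fun s => Sum.map id (a s))

/-! ### `⋁`-definable ideal schemas -/

/-- `J` is a proper ideal of the algebra of sets `B`. -/
structure IsProperIdeal {α : Type u} (B J : Set (Set α)) : Prop where
  subset : J ⊆ B
  empty_mem : ∅ ∈ J
  union_mem : ∀ D ∈ J, ∀ E ∈ J, D ∪ E ∈ J
  mem_of_subset : ∀ D ∈ J, ∀ E ∈ B, E ⊆ D → E ∈ J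
  univ_notMem : Set.univ ∉ J

/-- A `⋁`-preschema of partial types: it assigns to every partitioned formula `ψ(x, Y)` in the
context `x`, with any parameter variables `Y`, a set `¬I x.ψ(x, Y)` of formulas whose free variables
are among the free variables of `ψ` other than those in `x`. -/
structure Preschema (L : Language.{u}) (x : L.Sorts → Type u) where
  notI : ∀ {Y : L.Sorts → Type u}, Formula L (join x Y) → Set (Formula L Y)
  fv_subset : ∀ {Y : L.Sorts → Type u} (ψ : Formula L (join x Y)), ∀ θ ∈ notI ψ,
    ∀ v ∈ θ.fv, (⟨v.1, Sum.inr v.2⟩ : Σ s, join x Y s) ∈ ψ.fv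

namespace Preschema

variable {x : L.Sorts → Type u} (I : Preschema L x)

/-- `M ⊨ ¬I x.ψ(x, c)`. -/
def NotI (M : Struct L) {Y : L.Sorts → Type u} (ψ : Formula L (join x Y))
    (c : Tuple Y M.carrier) : Prop := ∀ θ ∈ I.notI ψ, M.Sat θ c

/-- `∼_M`-invariance: whether `M ⊨ ¬I x.ψ(x, c)` depends only on the set defined by `ψ(x, c)`. -/
def Invariant (M : Struct L) : Prop :=
  ∀ (Y Z : L.Sorts → Type u) (ψ : Formula L (join x Y)) (θ : Formula L (join x Z))
    (c : Tuple Y M.carrier) (d : Tuple Z M.carrier),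
    M.points ψ c = M.points θ d → (I.NotI M ψ c ↔ I.NotI M θ d)

/-- `I(M)`, the `M`-points of `I`: the sets defined by some `ψ(x, c)` with `M ⊭ ¬I x.ψ(x, c)`. -/
def idealPoints (M : Struct L) : Set (Set (Tuple x M.carrier)) :=
  {D | ∃ (Y : L.Sorts → Type u) (ψ : Formula L (join x Y)) (c : Tuple Y M.carrier),
    M.points ψ c = D ∧ ¬ I.NotI M ψ c}

/-- `I` is a `⋁`-definable ideal schema for `T`: it `⋁`-defines an ideal of the algebra of
definable subsets of `M_x`, for every model `M` of `T`. -/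
def IsIdealSchema (T : Set (Sentence L)) : Prop :=
  ∀ M : Struct L, M.Models T → I.Invariant M ∧ IsProperIdeal (M.Def x) (I.idealPoints M)

end Preschema

/-! ### Wide `φ`-types -/

section PhiTypes

variable {x y : L.Sorts → Type u}

/-- `φ`-formulas over `A`: the finite Boolean combinations of the formulas `φ(x, a)`, `a` a tuple in
`A`. (All Boolean connectives are built from `⊥` and `→`.) -/
inductive IsPhiFormula (φ : Formula L (join x y)) {M : Struct L} (A : M.Params) :
    Formula L (join x A.ctx) → Prop
  | inst (a : Tuple y A.ctx) : IsPhiFormula φ A (φ.inst a)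
  | falsum : IsPhiFormula φ A .falsum
  | imp {ψ θ : Formula L (join x A.ctx)} :
      IsPhiFormula φ A ψ → IsPhiFormula φ A θ → IsPhiFormula φ A (.imp ψ θ)

/-- `S_φ(A, M)`: the complete `φ`-types over `A`, that is, the sets of `φ`-formulas over `A` that
are maximal among those that are partial types with respect to `M`. -/
def phiTypes (φ : Formula L (join x y)) (M : Struct L) (A : M.Params) :
    Set (Set (Formula L (join x A.ctx))) :=
  {p | Maximal (fun q : Set (Formula L (join x A.ctx)) =>
    (∀ ψ ∈ q, IsPhiFormula φ A ψ) ∧ M.IsPartialType A q) p}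

/-- `S^I_φ(A, M)`: the complete `φ`-types over `A` none of whose members defines a set in `I(M)`. -/
def widePhiTypes (I : Preschema L x) (φ : Formula L (join x y)) (M : Struct L) (A : M.Params) :
    Set (Set (Formula L (join x A.ctx))) :=
  {p | p ∈ phiTypes φ M A ∧ ∀ ψ ∈ p, M.points ψ A.incl ∉ I.idealPoints M}

/-- A type `p(x)` over `M` is definable over `M`: for every partitioned formula `χ(x, z)` there is an
`L(M)`-formula `ψ(z)` that holds of `c` if `χ(x, c) ∈ p` and fails of `c` if `¬χ(x, c) ∈ p`. -/
def IsDefinableType (M : Struct L) (p : Set (Formula L (join x M.allParams.ctx))) : Prop :=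
  ∀ (z : L.Sorts → Type u) (χ : Formula L (join x z)),
    ∃ ψ : Formula L (join z M.allParams.ctx), ∀ c : Tuple z M.allParams.ctx,
      (χ.inst c ∈ p → M.Sat ψ (Tuple.append (fun s v => (c s v).1) M.allParams.incl)) ∧
      ((χ.inst c).neg ∈ p → ¬ M.Sat ψ (Tuple.append (fun s v => (c s v).1) M.allParams.incl))

/-! ### The rank and the tree -/

/-- `R^{I(M)}(ψ, φ, 2) ≥ n`, for `ψ(x)` an `L(M)`-formula. -/
def RankGE (I : Preschema L x) (φ : Formula L (join x y)) (M : Struct L) :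
    ℕ → Formula L (join x M.carrier) → Prop
  | 0, ψ => M.points ψ (fun _ m => m) ∉ I.idealPoints M
  | n + 1, ψ => ∃ c : Tuple y M.carrier, ∀ t : Bool,
      RankGE I φ M n (ψ.conj ((φ.inst c).pow t))

open Classical in
/-- The rank `R^{I(M)}(ψ, φ, 2)`, an element of `{-∞} ∪ ℕ ∪ {+∞}`, with `⊥ = -∞` and `⊤ = +∞`. -/
noncomputable def rank (I : Preschema L x) (φ : Formula L (join x y)) (M : Struct L)
    (ψ : Formula L (join x M.carrier)) : WithBot ℕ∞ :=
  if M.points ψ (fun _ m => m) ∈ I.idealPoints M then ⊥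
  else if ∀ n, RankGE I φ M n ψ then ⊤
  else ((sSup {n : ℕ | RankGE I φ M n ψ} : ℕ) : ℕ∞)

/-- The context `(y_s : s ∈ 2^{<ω})`: a copy of `y` for every finite binary sequence. -/
abbrev treeCtx (y : L.Sorts → Type u) : L.Sorts → Type u := fun s => List Bool × y s

/-- `φ(x, y_s)`. -/
def treeInst (φ : Formula L (join x y)) (s : List Bool) : Formula L (join x (treeCtx y)) :=
  φ.inst (fun _ v => (s, v))

/-- `σ ↾ n = (σ 0, …, σ (n - 1))`. -/
def restr (σ : ℕ → Bool) (n : ℕ) : List Bool := List.ofFn (fun i : Fin n => σ i)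

/-- The formula `x = x ∧ ⋀_{n ∈ K} φ(x, y_{σ ↾ n})^{σ(n)}`. -/
def branchFormula (φ : Formula L (join x y)) (σ : ℕ → Bool) (K : Finset ℕ) :
    Formula L (join x (treeCtx y)) :=
  BFormula.verum.conj
    (BFormula.bigConj ((K.sort (· ≤ ·)).map fun n => (treeInst φ (restr σ n)).pow (σ n)))

/-- The wide binary tree `Tree[I, φ, ω]`. -/
def Tree (I : Preschema L x) (φ : Formula L (join x y)) : Set (Formula L (treeCtx y)) :=
  {θ | ∃ (σ : ℕ → Bool) (K : Finset ℕ), θ ∈ I.notI (branchFormula φ σ K)}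

/-- The set `Γ` of formulas in the free variables `V` is consistent with `T`. -/
def ConsistentWith {V : L.Sorts → Type u} (T : Set (Sentence L)) (Γ : Set (Formula L V)) : Prop :=
  ∃ M : Struct L, M.Models T ∧ ∃ b : Tuple V M.carrier, ∀ θ ∈ Γ, M.Sat θ b

end PhiTypes

end ManySorted

/-! This is the local stability theorem for `φ` relative to an ideal: "consistent" is replaced
throughout by "wide", meaning outside `I(M)`. Two facts let the classical arguments survive.
Wideness of `ψ(x, c)` is a type-definable condition on `c`, so compactness applies to it. And a set
of `φ`-formulas with wide finite conjunctions extends to a wide complete `φ`-type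
(`exists_widePhiType`).

If the tree is consistent, compactness stretches it from height `ω` to the least `μ` with `2 ^ μ >
λ` (`exists_wide_tree`). Its nodes supply at most `λ` parameters while its `2 ^ μ` branches carry
distinct wide types, so (b) fails (`not_consistentWith_tree`). Rank at least `n` means that a wide
tree of height `n` exists (`wideRankGE_iff_pathSet`), so unbounded rank makes the tree consistent
(`consistentWith_tree`). Conversely, a tree in any model makes the rank there infinite. As "rank at
least `n`" is the realizability of a type in finitely many variables (`wideRankGE_typeDefinable`),
completeness of `T` carries it into every `ω`-saturated model.

If the rank is finite, choose `ψ` of least rank `n` in a wide type `p`. For each `c`, at most one of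
`ψ ∧ φ(x, c)` and `ψ ∧ ¬φ(x, c)` has rank at least `n`, and the one belonging to `p` does. The two
conditions on `c` are disjoint and type-definable, so by saturation a formula separates them, and it
defines `p` on instances of `φ` (`isDefinableType_of_rank`). A syntactic argument extends this to
all formulas `χ` (`isDefinableType_of_definable`).

Finally, `A` embeds elementarily in an `ω`-saturated `N` with at most `λ` elements. Wide types over
`A` extend to distinct wide types over `N`, and these are determined by their defining formulas over
`N`, of which there are at most `λ` (`mk_widePhiTypes_le`). The bound `2 ^ |L| ≤ λ` is the cost of
building `N` (`exists_omegaSaturated`). -/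

namespace ManySorted

variable {L : Language.{u}}

/-! ### Basic semantics -/

section Semantics

variable {V W : L.Sorts → Type u}

theorem Term.eval_relabel (M : Struct L) (g : ∀ s, V s → W s) (a : Tuple W M.carrier)
    {s : L.Sorts} (t : Term L V s) :
    (t.relabel g).eval M a = t.eval M (fun s v => a s (g s v)) := by
  induction t with
  | var v => rfl
  | app f ts ih => simp only [Term.relabel, Term.eval, ih]

theorem Tuple.append_comp_map {V' M : L.Sorts → Type u} (g : ∀ s, V s → W s) (a : Tuple W M)
    (b : Tuple V' M) :
    (fun s v => (a.append b) s (Sum.map (g s) id v)) =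
      Tuple.append (fun s v => a s (g s v)) b := by
  funext s v
  cases v <;> rfl

theorem BFormula.holds_relabel (M : Struct L) (g : ∀ s, V s → W s) (a : Tuple W M.carrier)
    {l : List L.Sorts} (ψ : BFormula L V l) (b : Tuple (BVar l) M.carrier) :
    (ψ.relabel g).Holds M a b ↔ ψ.Holds M (fun s v => a s (g s v)) b := by
  induction ψ with
  | falsum => rfl
  | equal t₁ t₂ =>
    simp only [BFormula.relabel, BFormula.Holds, Term.eval_relabel, Tuple.append_comp_map]
  | rel R ts =>
    simp only [BFormula.relabel, BFormula.Holds, Term.eval_relabel, Tuple.append_comp_map]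
  | imp ψ θ ih₁ ih₂ => simp only [BFormula.relabel, BFormula.Holds, ih₁, ih₂]
  | all s ψ ih => simp only [BFormula.relabel, BFormula.Holds, ih]

@[simp] theorem Struct.sat_relabel (M : Struct L) (g : ∀ s, V s → W s) (a : Tuple W M.carrier)
    (ψ : Formula L V) : M.Sat (ψ.relabel g) a ↔ M.Sat ψ (fun s v => a s (g s v)) :=
  BFormula.holds_relabel M g a ψ _

@[simp] theorem Struct.sat_falsum (M : Struct L) (a : Tuple V M.carrier) :
    ¬ M.Sat (.falsum : Formula L V) a := fun h => h

@[simp] theorem Struct.sat_imp (M : Struct L) (a : Tuple V M.carrier) (ψ θ : Formula L V) :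
    M.Sat (.imp ψ θ) a ↔ (M.Sat ψ a → M.Sat θ a) := Iff.rfl

@[simp] theorem Struct.sat_neg (M : Struct L) (a : Tuple V M.carrier) (ψ : Formula L V) :
    M.Sat ψ.neg a ↔ ¬ M.Sat ψ a := Iff.rfl

@[simp] theorem Struct.sat_verum (M : Struct L) (a : Tuple V M.carrier) :
    M.Sat (.verum : Formula L V) a := fun h => h

@[simp] theorem Struct.sat_conj (M : Struct L) (a : Tuple V M.carrier) (ψ θ : Formula L V) :
    M.Sat (ψ.conj θ) a ↔ M.Sat ψ a ∧ M.Sat θ a := by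
  simp [BFormula.conj]

@[simp] theorem Struct.sat_bigConj (M : Struct L) (a : Tuple V M.carrier)
    (ψs : List (Formula L V)) :
    M.Sat (BFormula.bigConj ψs) a ↔ ∀ ψ ∈ ψs, M.Sat ψ a := by
  induction ψs with
  | nil => simp [BFormula.bigConj]
  | cons ψ ψs ih =>
    have : BFormula.bigConj (ψ :: ψs) = ψ.conj (BFormula.bigConj ψs) := rfl
    rw [this, Struct.sat_conj, ih]; simp

theorem Struct.sat_pow (M : Struct L) (a : Tuple V M.carrier) (ψ : Formula L V) (t : Bool) :
    M.Sat (ψ.pow t) a ↔ (M.Sat ψ a ↔ t = true) := by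
  cases t <;> simp [BFormula.pow]

theorem Struct.sat_inst (M : Struct L) {x y Z : L.Sorts → Type u} (φ : Formula L (join x y))
    (b : Tuple y Z) (a : Tuple x M.carrier) (c : Tuple Z M.carrier) :
    M.Sat (φ.inst b) (a.append c) ↔ M.Sat φ (a.append fun s v => c s (b s v)) := by
  rw [BFormula.inst, Struct.sat_relabel]
  apply iff_of_eq
  congr 1
  funext s v
  cases v <;> rfl

end Semantics

/-! ### Renaming free and bound variables -/

section Rename

variable {V W : L.Sorts → Type u}

/-- Extension of a renaming of free and bound variables under a quantifier. -/
def liftVar {l m : List L.Sorts} (t : L.Sorts)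
    (ρ : ∀ s, join V (BVar l) s → join W (BVar m) s) :
    ∀ s, join V (BVar (t :: l)) s → join W (BVar (t :: m)) s
  | s, .inl v => Sum.map id BVar.succ (ρ s (.inl v))
  | _, .inr .zero => .inr .zero
  | s, .inr (.succ w) => Sum.map id BVar.succ (ρ s (.inr w))

/-- Renaming of free and bound variables, possibly freeing or binding some of them. -/
def BFormula.rename : ∀ {l m : List L.Sorts},
    (∀ s, join V (BVar l) s → join W (BVar m) s) → BFormula L V l → BFormula L W m
  | _, _, _, .falsum => .falsum
  | _, _, ρ, .equal t₁ t₂ => .equal (t₁.relabel ρ) (t₂.relabel ρ)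
  | _, _, ρ, .rel R ts => .rel R fun i => (ts i).relabel ρ
  | _, _, ρ, .imp ψ θ => .imp (ψ.rename ρ) (θ.rename ρ)
  | _, _, ρ, .all t ψ => .all t (ψ.rename (liftVar t ρ))

/-- A renaming may move variables between free and bound, so the two pairs of assignments are only
required to agree through `ρ`; this form is stable under passing a quantifier. -/
theorem BFormula.holds_rename (M : Struct L) {l m : List L.Sorts} (ψ : BFormula L V l)
    (ρ : ∀ s, join V (BVar l) s → join W (BVar m) s)
    (a : Tuple W M.carrier) (b : Tuple (BVar m) M.carrier)
    (a' : Tuple V M.carrier) (b' : Tuple (BVar l) M.carrier)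
    (h : ∀ s v, a'.append b' s v = a.append b s (ρ s v)) :
    (ψ.rename ρ).Holds M a b ↔ ψ.Holds M a' b' := by
  induction ψ generalizing m with
  | falsum => rfl
  | equal t₁ t₂ =>
    have h' : (fun s v => a.append b s (ρ s v)) = a'.append b' := by funext s v; rw [h]
    simp only [BFormula.rename, BFormula.Holds, Term.eval_relabel, h']
  | rel R ts =>
    have h' : (fun s v => a.append b s (ρ s v)) = a'.append b' := by funext s v; rw [h]
    simp only [BFormula.rename, BFormula.Holds, Term.eval_relabel, h']
  | imp ψ θ ih₁ ih₂ =>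
    simp only [BFormula.rename, BFormula.Holds, ih₁ ρ b b' h, ih₂ ρ b b' h]
  | all t ψ ih =>
    simp only [BFormula.rename, BFormula.Holds]
    refine forall_congr' fun n => ih _ _ _ ?_
    have aux : ∀ s (w : join W (BVar m) s),
        a.append (BVar.cons n b) s (Sum.map id BVar.succ w) = a.append b s w := by
      intro s w; cases w <;> rfl
    intro s v
    match s, v with
    | s, .inl v => exact (h s (.inl v)).trans (aux s _).symm
    | _, .inr .zero => rfl
    | s, .inr (.succ w) => exact (h s (.inr w)).trans (aux s _).symm

/-- Existential closure of a formula over its bound variables. -/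
def BFormula.exClose : ∀ {l : List L.Sorts}, BFormula L V l → Formula L V
  | [], ψ => ψ
  | t :: _, ψ => BFormula.exClose (BFormula.all t ψ.neg).neg

theorem BVar.eq_nil {M : L.Sorts → Type u} (b : Tuple (BVar ([] : List L.Sorts)) M) :
    b = BVar.nil := by
  funext s v; cases v

theorem BVar.exists_cons {M : L.Sorts → Type u} {t : L.Sorts} {l : List L.Sorts}
    (b : Tuple (BVar (t :: l)) M) : ∃ m b', b = BVar.cons m b' := by
  refine ⟨b t .zero, fun s v => b s v.succ, ?_⟩
  funext s v; cases v <;> rfl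

theorem BFormula.sat_exClose (M : Struct L) (a : Tuple V M.carrier) {l : List L.Sorts}
    (ψ : BFormula L V l) : M.Sat ψ.exClose a ↔ ∃ b, ψ.Holds M a b := by
  induction l with
  | nil =>
    constructor
    · intro h; exact ⟨_, h⟩
    · rintro ⟨b, h⟩; rw [BVar.eq_nil b] at h; exact h
  | cons t l ih =>
    rw [BFormula.exClose, ih]
    constructor
    · rintro ⟨b, h⟩
      simp only [BFormula.neg, BFormula.Holds] at h
      by_contra h'
      exact h fun m hm => h' ⟨_, hm⟩
    · rintro ⟨b, h⟩
      obtain ⟨m, b', rfl⟩ := BVar.exists_cons b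
      exact ⟨b', fun h' => h' m h⟩

end Rename

/-! ### Free variables -/

section FreeVars

variable {V W : L.Sorts → Type u}

theorem Term.finite_vars {s : L.Sorts} (t : Term L V s) : t.vars.Finite := by
  induction t with
  | var v => exact Set.finite_singleton _
  | app f ts ih => exact Set.finite_iUnion ih

theorem BFormula.finite_fv {l : List L.Sorts} (ψ : BFormula L V l) : ψ.fv.Finite := by
  have key : ∀ {l : List L.Sorts} (S : Set (Σ s, join V (BVar l) s)), S.Finite →
      {v : Σ s, V s | (⟨v.1, Sum.inl v.2⟩ : Σ s, join V (BVar l) s) ∈ S}.Finite := by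
    intro l S hS
    refine hS.preimage ?_
    rintro ⟨s, v⟩ - ⟨s', v'⟩ - h
    simp only [Sigma.mk.injEq] at h
    obtain ⟨rfl, h⟩ := h
    simpa using h
  induction ψ with
  | falsum => exact Set.finite_empty
  | equal t₁ t₂ => exact key _ (t₁.finite_vars.union t₂.finite_vars)
  | rel R ts =>
    have := key _ (Set.finite_iUnion fun i => (ts i).finite_vars)
    simp only [Set.mem_iUnion] at this
    exact this
  | imp ψ θ ih₁ ih₂ => exact ih₁.union ih₂
  | all s ψ ih => exact ih

theorem Term.exists_relabel_eq {U : L.Sorts → Type u} (g : ∀ s, U s → V s) {s : L.Sorts}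
    (t : Term L V s) (h : ∀ v ∈ t.vars, ∃ w, g v.1 w = v.2) :
    ∃ t' : Term L U s, t'.relabel g = t := by
  induction t with
  | var v =>
    obtain ⟨w, hw⟩ := h ⟨_, v⟩ rfl
    exact ⟨.var w, congrArg Term.var hw⟩
  | app f ts ih =>
    choose ts' h' using fun i => ih i fun v hv => h v (Set.mem_iUnion.2 ⟨i, hv⟩)
    exact ⟨.app f ts', by simp only [Term.relabel, h']⟩

/-- Applied to the inclusion of the free variables, this cuts any context down to a finite one. No
injectivity of `g` is needed, since preimages of variables are simply chosen. -/
theorem BFormula.exists_relabel_eq {U : L.Sorts → Type u} (g : ∀ s, U s → V s)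
    {l : List L.Sorts} (ψ : BFormula L V l) (h : ∀ v ∈ ψ.fv, ∃ w, g v.1 w = v.2) :
    ∃ ψ' : BFormula L U l, ψ'.relabel g = ψ := by
  have key : ∀ {l : List L.Sorts} {s : L.Sorts} (t : Term L (join V (BVar l)) s),
      (∀ v : Σ s, V s, ⟨v.1, Sum.inl v.2⟩ ∈ t.vars → ∃ w, g v.1 w = v.2) →
      ∃ t' : Term L (join U (BVar l)) s, t'.relabel (fun s => Sum.map (g s) id) = t := by
    intro l s t ht
    refine t.exists_relabel_eq _ ?_
    rintro ⟨s, v | v⟩ hv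
    · obtain ⟨w, hw⟩ := ht ⟨s, v⟩ hv
      exact ⟨.inl w, congrArg Sum.inl hw⟩
    · exact ⟨.inr v, rfl⟩
  induction ψ with
  | falsum => exact ⟨.falsum, rfl⟩
  | equal t₁ t₂ =>
    obtain ⟨t₁', h₁⟩ := key t₁ fun v hv => h v (Or.inl hv)
    obtain ⟨t₂', h₂⟩ := key t₂ fun v hv => h v (Or.inr hv)
    exact ⟨.equal t₁' t₂', by simp only [BFormula.relabel, h₁, h₂]⟩
  | rel R ts =>
    choose ts' h' using fun i => key (ts i) fun v hv => h v ⟨i, hv⟩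
    exact ⟨.rel R ts', by simp only [BFormula.relabel, h']⟩
  | imp ψ θ ih₁ ih₂ =>
    obtain ⟨ψ', h₁⟩ := ih₁ fun v hv => h v (Or.inl hv)
    obtain ⟨θ', h₂⟩ := ih₂ fun v hv => h v (Or.inr hv)
    exact ⟨.imp ψ' θ', by simp only [BFormula.relabel, h₁, h₂]⟩
  | all s ψ ih =>
    obtain ⟨ψ', h'⟩ := ih h
    exact ⟨.all s ψ', by simp only [BFormula.relabel, h']⟩

theorem Term.relabel_injective {g : ∀ s, V s → W s} (hg : ∀ s, Function.Injective (g s))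
    {s : L.Sorts} : Function.Injective (Term.relabel g : Term L V s → Term L W s) := by
  intro t t' h
  induction t with
  | var v =>
    cases t' with
    | var v' => simp only [Term.relabel, Term.var.injEq] at h; rw [hg _ h]
    | app f ts => simp [Term.relabel] at h
  | app f ts ih =>
    cases t' with
    | var v' => simp [Term.relabel] at h
    | app f' ts' =>
      simp only [Term.relabel, Term.app.injEq] at h
      obtain ⟨rfl, hf, hts⟩ := h
      cases hf
      rw [heq_eq_eq] at hts
      congr 1
      funext i
      exact ih i (congrFun hts i)

theorem BFormula.relabel_injective {g : ∀ s, V s → W s} (hg : ∀ s, Function.Injective (g s))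
    {l : List L.Sorts} :
    Function.Injective (BFormula.relabel g : BFormula L V l → BFormula L W l) := by
  have hg' : ∀ (l : List L.Sorts) s, Function.Injective
      (Sum.map (g s) id : join V (BVar l) s → join W (BVar l) s) :=
    fun l s => Sum.map_injective.2 ⟨hg s, Function.injective_id⟩
  intro ψ ψ' h
  induction ψ with
  | falsum => cases ψ' <;> simp [BFormula.relabel] at h ⊢
  | equal t₁ t₂ =>
    cases ψ' <;> simp only [BFormula.relabel, reduceCtorEq, BFormula.equal.injEq] at h
    obtain ⟨rfl, h₁, h₂⟩ := h
    rw [heq_eq_eq] at h₁ h₂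
    rw [Term.relabel_injective (hg' _) h₁, Term.relabel_injective (hg' _) h₂]
  | rel R ts =>
    cases ψ' <;> simp only [BFormula.relabel, reduceCtorEq, BFormula.rel.injEq] at h
    obtain ⟨rfl, hR, h₂⟩ := h
    cases hR
    rw [heq_eq_eq] at h₂
    congr 1
    funext i
    exact Term.relabel_injective (hg' _) (congrFun h₂ i)
  | imp ψ θ ih₁ ih₂ =>
    cases ψ' <;> simp only [BFormula.relabel, reduceCtorEq, BFormula.imp.injEq] at h
    rw [ih₁ h.1, ih₂ h.2]
  | all s ψ ih =>
    cases ψ' <;> simp only [BFormula.relabel, reduceCtorEq, BFormula.all.injEq] at h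
    obtain ⟨rfl, h⟩ := h
    rw [heq_eq_eq] at h
    rw [ih h]

end FreeVars

/-! ### Quantifying over tuples -/

section Quantify

variable {z V W : L.Sorts → Type u}

/-- Variables outside the range of `g` receive arbitrary values, which exist because all sorts are
nonempty. -/
theorem Struct.exists_extend (M : Struct L) {U : L.Sorts → Type u} (g : ∀ s, U s → V s)
    (hg : ∀ s, Function.Injective (g s)) (c : Tuple U M.carrier) :
    ∃ b : Tuple V M.carrier, ∀ s v, b s (g s v) = c s v :=
  ⟨fun s => Function.extend (g s) (c s) fun _ => (M.nonempty s).some,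
    fun s _ => (hg s).extend_apply _ _ _⟩

theorem BVar.finite (l : List L.Sorts) : Finite (Σ s, BVar l s) := by
  induction l with
  | nil => exact Finite.of_injective (β := Empty) (nomatch ·.2) (nomatch ·.2)
  | cons t l ih =>
    refine Finite.of_surjective (α := Option (Σ s, BVar l s))
      (fun v => v.elim ⟨t, .zero⟩ fun w => ⟨w.1, .succ w.2⟩) ?_
    rintro ⟨s, v⟩
    cases v with
    | zero => exact ⟨none, rfl⟩
    | succ w => exact ⟨some ⟨s, w⟩, rfl⟩

/-- An injection is enough to quantify over `z`: superfluous bound variables are harmless when the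
sorts are nonempty. -/
theorem exists_bvar_injection (hz : Finite (Σ s, z s)) :
    ∃ (l : List L.Sorts) (g : ∀ s, z s → BVar l s), ∀ s, Function.Injective (g s) := by
  classical
  have key : ∀ w : List (Σ s, z s), ∃ (l : List L.Sorts)
      (g : ∀ s, {v : z s // (⟨s, v⟩ : Σ s, z s) ∈ w} → BVar l s), ∀ s, Function.Injective (g s) := by
    intro w
    induction w with
    | nil =>
      exact ⟨[], fun s v => absurd v.2 List.not_mem_nil,
        fun s v => absurd v.2 List.not_mem_nil⟩
    | cons v₀ w ih =>
      obtain ⟨l, g, hg⟩ := ih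
      refine ⟨v₀.1 :: l, fun s v =>
        if h : (⟨s, v.1⟩ : Σ s, z s) ∈ w then .succ (g s ⟨v.1, h⟩)
        else
          have h' : v₀.1 = s := by
            rcases List.mem_cons.1 v.2 with h' | h'
            · exact (congrArg Sigma.fst h').symm
            · exact absurd h' h
          h' ▸ .zero, ?_⟩
      rintro s ⟨v, hv⟩ ⟨v', hv'⟩ h
      obtain ⟨s₀, v₀⟩ := v₀
      -- The head variable, even after transport along an equality of sorts, never collides with a
      -- shifted one.
      have hz' : ∀ {t : L.Sorts} (e : s₀ = t) (w : BVar l t),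
          (e ▸ (BVar.zero : BVar (s₀ :: l) s₀) : BVar (s₀ :: l) t) ≠ .succ w := by
        rintro t rfl w h; cases h
      by_cases h₁ : (⟨s, v⟩ : Σ s, z s) ∈ w <;> by_cases h₂ : (⟨s, v'⟩ : Σ s, z s) ∈ w
      · simp only [h₁, h₂, dite_true, BVar.succ.injEq] at h
        exact Subtype.ext (by simpa using hg s h)
      · simp only [h₁, h₂, dite_true, dite_false] at h
        exact absurd h.symm (hz' _ _)
      · simp only [h₁, h₂, dite_true, dite_false] at h
        exact absurd h (hz' _ _)
      · have e₁ := (List.mem_cons.1 hv).resolve_right h₁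
        have e₂ := (List.mem_cons.1 hv').resolve_right h₂
        have := e₁.trans e₂.symm
        simp only [Sigma.mk.injEq, heq_eq_eq, true_and] at this
        exact Subtype.ext this
  have := Fintype.ofFinite (Σ s, z s)
  obtain ⟨l, g, hg⟩ := key Finset.univ.toList
  refine ⟨l, fun s v => g s ⟨v, by simp⟩, fun s v v' h => ?_⟩
  exact congrArg Subtype.val (hg s h)

theorem exists_quantified_of_finite (hz : Finite (Σ s, z s)) (ψ : Formula L (join z V)) :
    ∃ χ : Formula L V, ∀ (M : Struct L) (a : Tuple V M.carrier),
      M.Sat χ a ↔ ∃ c : Tuple z M.carrier, M.Sat ψ (c.append a) := by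
  obtain ⟨l, g, hg⟩ := exists_bvar_injection hz
  let ρ : ∀ s, join (join z V) (BVar []) s → join V (BVar l) s
    | s, .inl (.inl v) => .inr (g s v)
    | _, .inl (.inr v) => .inl v
  refine ⟨(BFormula.rename ρ ψ).exClose, fun M a => ?_⟩
  rw [BFormula.sat_exClose]
  have hρ : ∀ (b : Tuple (BVar l) M.carrier) (c : Tuple z M.carrier),
      (∀ s v, b s (g s v) = c s v) →
        ((BFormula.rename ρ ψ).Holds M a b ↔ M.Sat ψ (c.append a)) := by
    intro b c h
    refine BFormula.holds_rename M ψ ρ a b (c.append a) BVar.nil ?_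
    rintro s ((v | v) | v)
    · exact (h s v).symm
    · rfl
    · cases v
  constructor
  · rintro ⟨b, hb⟩
    exact ⟨fun s v => b s (g s v), (hρ b _ fun _ _ => rfl).1 hb⟩
  · rintro ⟨c, hc⟩
    obtain ⟨b, hb⟩ := M.exists_extend g hg c
    exact ⟨b, (hρ b c hb).2 hc⟩

theorem finite_subtype_context {S : Set (Σ s, V s)} (hS : S.Finite) :
    Finite (Σ s, {v : V s // (⟨s, v⟩ : Σ s, V s) ∈ S}) := by
  have := hS.to_subtype
  refine Finite.of_injective (β := S) (fun v => ⟨⟨v.1, v.2.1⟩, v.2.2⟩) ?_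
  rintro ⟨s, v, hv⟩ ⟨s', v', hv'⟩ h
  simp only [Subtype.mk.injEq, Sigma.mk.injEq] at h
  obtain ⟨rfl, h⟩ := h
  rw [heq_eq_eq] at h
  subst h
  rfl

/-- The context `z` may be infinite: only finitely many of its variables occur in `ψ`, and the
values of the others are irrelevant. -/
theorem exists_quantified (ψ : Formula L (join z V)) :
    ∃ χ : Formula L V, ∀ (M : Struct L) (a : Tuple V M.carrier),
      M.Sat χ a ↔ ∃ c : Tuple z M.carrier, M.Sat ψ (c.append a) := by
  let S : Set (Σ s, z s) := {v | (⟨v.1, .inl v.2⟩ : Σ s, join z V s) ∈ ψ.fv}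
  have hS : S.Finite := by
    refine ψ.finite_fv.preimage ?_
    rintro ⟨s, v⟩ - ⟨s', v'⟩ - h
    simp only [Sigma.mk.injEq] at h
    obtain ⟨rfl, h⟩ := h
    simpa using h
  let U : L.Sorts → Type u := fun s => {v : z s // (⟨s, v⟩ : Σ s, z s) ∈ S}
  obtain ⟨ψ', hψ⟩ := BFormula.exists_relabel_eq (U := join U V)
    (fun s => Sum.map Subtype.val id) ψ (by
      rintro ⟨s, v | v⟩ hv
      · exact ⟨.inl ⟨v, hv⟩, rfl⟩
      · exact ⟨.inr v, rfl⟩)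
  obtain ⟨χ, hχ⟩ := exists_quantified_of_finite (finite_subtype_context hS) ψ'
  refine ⟨χ, fun M a => ?_⟩
  rw [hχ, ← hψ]
  constructor
  · rintro ⟨c, hc⟩
    obtain ⟨b, hb⟩ := M.exists_extend (fun s => (Subtype.val : U s → z s))
      (fun s => Subtype.val_injective) c
    refine ⟨b, ?_⟩
    rw [Struct.sat_relabel, Tuple.append_comp_map]
    simpa only [hb] using hc
  · rintro ⟨c, hc⟩
    rw [Struct.sat_relabel, Tuple.append_comp_map] at hc
    exact ⟨_, hc⟩

/-- `a` in `M` and `b` in `N` satisfy the same formulas. -/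
def ElemEq (M : Struct L) (a : Tuple V M.carrier) (N : Struct L) (b : Tuple V N.carrier) : Prop :=
  ∀ χ : Formula L V, M.Sat χ a ↔ N.Sat χ b

theorem ElemEq.of_imp {M N : Struct L} {a : Tuple V M.carrier} {b : Tuple V N.carrier}
    (h : ∀ χ : Formula L V, M.Sat χ a → N.Sat χ b) : ElemEq M a N b :=
  fun χ => ⟨h χ, fun hN => by_contra fun hM => h χ.neg hM hN⟩

theorem ElemEq.symm {M N : Struct L} {a : Tuple V M.carrier} {b : Tuple V N.carrier}
    (h : ElemEq M a N b) : ElemEq N b M a := fun χ => (h χ).symm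

theorem ElemEq.trans {M N P : Struct L} {a : Tuple V M.carrier} {b : Tuple V N.carrier}
    {c : Tuple V P.carrier} (h : ElemEq M a N b) (h' : ElemEq N b P c) : ElemEq M a P c :=
  fun χ => (h χ).trans (h' χ)

theorem ElemEq.comp {M N : Struct L} {a : Tuple V M.carrier} {b : Tuple V N.carrier}
    (h : ElemEq M a N b) (g : ∀ s, W s → V s) :
    ElemEq M (fun s v => a s (g s v)) N (fun s v => b s (g s v)) := fun χ => by
  simpa using h (χ.relabel g)

/-- `p(z, a)` is finitely satisfiable in `M`. -/
def FinSat (M : Struct L) (p : Set (Formula L (join z V))) (a : Tuple V M.carrier) : Prop :=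
  ∀ F : Finset (Formula L (join z V)), ↑F ⊆ p →
    ∃ c : Tuple z M.carrier, ∀ θ ∈ F, M.Sat θ (c.append a)

theorem exists_quantified_finset (F : Finset (Formula L (join z V))) :
    ∃ χ : Formula L V, ∀ (M : Struct L) (a : Tuple V M.carrier),
      M.Sat χ a ↔ ∃ c : Tuple z M.carrier, ∀ θ ∈ F, M.Sat θ (c.append a) := by
  obtain ⟨χ, hχ⟩ := exists_quantified (BFormula.bigConj F.toList)
  refine ⟨χ, fun M a => ?_⟩
  simp [hχ]

/-- Satisfiability of each finite part is a single formula about the parameters. -/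
theorem FinSat.transfer {M N : Struct L} {a : Tuple V M.carrier} {b : Tuple V N.carrier}
    {p : Set (Formula L (join z V))} (hp : FinSat M p a) (h : ElemEq M a N b) :
    FinSat N p b := by
  intro F hF
  obtain ⟨χ, hχ⟩ := exists_quantified_finset F
  exact (hχ N b).1 ((h χ).1 ((hχ M a).2 (hp F hF)))

theorem FinSat.of_realize {M : Struct L} {a : Tuple V M.carrier}
    {p : Set (Formula L (join z V))} {c : Tuple z M.carrier}
    (h : ∀ θ ∈ p, M.Sat θ (c.append a)) : FinSat M p a :=
  fun _ hF => ⟨c, fun θ hθ => h θ (hF hθ)⟩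

theorem Tuple.append_comp_sumMap {V' W' M : L.Sorts → Type u} (f : ∀ s, V s → V' s)
    (g : ∀ s, W s → W' s) (a : Tuple V' M) (b : Tuple W' M) :
    (fun s v => (a.append b) s (Sum.map (f s) (g s) v)) =
      Tuple.append (fun s v => a s (f s v)) (fun s v => b s (g s v)) := by
  funext s v
  cases v <;> rfl

theorem FinSat.image {z' : L.Sorts → Type u} {M : Struct L} {a : Tuple W M.carrier}
    {f : ∀ s, z s → z' s} (hf : ∀ s, Function.Injective (f s)) {g : ∀ s, V s → W s}
    {p : Set (Formula L (join z V))} (h : FinSat M p fun s v => a s (g s v)) :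
    FinSat M ((fun θ => θ.relabel fun s => Sum.map (f s) (g s)) '' p) a := by
  classical
  intro F hF
  obtain ⟨F', hF', rfl⟩ := Finset.subset_set_image_iff.1 hF
  obtain ⟨c, hc⟩ := h F' hF'
  obtain ⟨b, hb⟩ := M.exists_extend f hf c
  refine ⟨b, fun θ hθ => ?_⟩
  obtain ⟨θ', hθ', rfl⟩ := Finset.mem_image.1 hθ
  rw [Struct.sat_relabel, Tuple.append_comp_sumMap]
  simpa only [hb] using hc θ' hθ'

end Quantify

/-! ### Ultraproducts -/

section Ultraproduct

open Filter

variable {ι : Type u} (U : Ultrafilter ι) (M : ι → Struct L)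

/-- The ultraproduct of a family of structures. -/
noncomputable def ultraproduct : Struct L where
  carrier s := (U : Filter ι).Product fun i => (M i).carrier s
  nonempty s := ⟨Quotient.mk (productSetoid _ _) fun i => ((M i).nonempty s).some⟩
  funMap f xs := Quotient.mk (productSetoid _ _) fun i => (M i).funMap f fun j => (xs j).out i
  relMap R xs := ∀ᶠ i in (U : Filter ι), (M i).relMap R fun j => (xs j).out i

variable {U M}

/-- The element of the ultraproduct represented by a family of elements. -/
def ultraElem {s : L.Sorts} (m : ∀ i, (M i).carrier s) : (ultraproduct U M).carrier s :=
  Quotient.mk (productSetoid (U : Filter ι) fun i => (M i).carrier s) m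

/-- The tuple of the ultraproduct represented by a family of tuples. -/
def ultraMk {V : L.Sorts → Type u} (a : ∀ i, Tuple V (M i).carrier) :
    Tuple V (ultraproduct U M).carrier :=
  fun s v => ultraElem fun i => a i s v

theorem ultraElem_eq_iff {s : L.Sorts} {m m' : ∀ i, (M i).carrier s} :
    (ultraElem m : (ultraproduct U M).carrier s) = ultraElem m' ↔
      ∀ᶠ i in (U : Filter ι), m i = m' i :=
  Quotient.eq (r := productSetoid (U : Filter ι) fun i => (M i).carrier s)

/-- The ultraproduct interprets symbols through chosen representatives. As a symbol has finitely
many arguments, these agree simultaneously with any given representatives on a large set of indices.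
-/
theorem eventually_out_eq {n : ℕ} {l : Fin n → L.Sorts}
    (a : ∀ j : Fin n, ∀ i, (M i).carrier (l j)) :
    ∀ᶠ i in (U : Filter ι), (fun j => Quotient.out (Quotient.mk
      (productSetoid (U : Filter ι) fun i => (M i).carrier (l j)) (a j)) i) = fun j => a j i := by
  have : ∀ᶠ i in (U : Filter ι), ∀ j, Quotient.out (Quotient.mk
      (productSetoid (U : Filter ι) fun i => (M i).carrier (l j)) (a j)) i = a j i :=
    eventually_all.2 fun j => Quotient.mk_out (s := productSetoid (U : Filter ι) fun i =>
      (M i).carrier (l j)) (a j)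
  filter_upwards [this] with i hi
  exact funext hi

theorem eval_ultraMk {V : L.Sorts → Type u} (a : ∀ i, Tuple V (M i).carrier) {s : L.Sorts}
    (t : Term L V s) : t.eval (ultraproduct U M) (ultraMk a) =
      ultraElem fun i => t.eval (M i) (a i) := by
  induction t with
  | var v => rfl
  | app f ts ih =>
    simp only [Term.eval, ih]
    refine ultraElem_eq_iff.2 ?_
    filter_upwards [eventually_out_eq (U := U) (M := M)
      fun j i => (ts j).eval (M i) (a i)] with i hi
    exact congrArg _ hi

theorem ultraMk_append {V W : L.Sorts → Type u} (a : ∀ i, Tuple V (M i).carrier)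
    (b : ∀ i, Tuple W (M i).carrier) :
    Tuple.append (ultraMk a : Tuple V (ultraproduct U M).carrier) (ultraMk b) =
      ultraMk fun i => (a i).append (b i) := by
  funext s v
  cases v <;> rfl

/-- Łoś's theorem, with bound variables. -/
theorem holds_ultraMk {V : L.Sorts → Type u} (a : ∀ i, Tuple V (M i).carrier)
    {l : List L.Sorts} (ψ : BFormula L V l) (b : ∀ i, Tuple (BVar l) (M i).carrier) :
    ψ.Holds (ultraproduct U M) (ultraMk a) (ultraMk b) ↔
      ∀ᶠ i in (U : Filter ι), ψ.Holds (M i) (a i) (b i) := by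
  induction ψ with
  | falsum => simp [BFormula.Holds, Filter.eventually_false_iff_eq_bot, U.neBot.ne]
  | equal t₁ t₂ =>
    simp only [BFormula.Holds, ultraMk_append, eval_ultraMk]
    exact ultraElem_eq_iff
  | rel R ts =>
    simp only [BFormula.Holds, ultraMk_append, eval_ultraMk]
    refine eventually_congr ?_
    filter_upwards [eventually_out_eq (U := U) (M := M)
      fun j i => (ts j).eval (M i) ((a i).append (b i))] with i hi
    exact iff_of_eq (congrArg _ hi)
  | imp ψ θ ih₁ ih₂ =>
    simp only [BFormula.Holds, ih₁, ih₂]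
    exact Ultrafilter.eventually_imp.symm
  | all s ψ ih =>
    have hc : ∀ m : ∀ i, (M i).carrier s,
        BVar.cons (M := (ultraproduct U M).carrier) (ultraElem m) (ultraMk b) =
        ultraMk fun i => BVar.cons (m i) (b i) := by
      intro m
      funext s v
      cases v <;> rfl
    simp only [BFormula.Holds]
    constructor
    · intro h
      by_contra hn
      rw [← Ultrafilter.eventually_not] at hn
      classical
      -- A counterexample is selected at every index having one; elsewhere the value is arbitrary.
      have := h (ultraElem fun i =>
        if h : ∃ m, ¬ ψ.Holds (M i) (a i) (BVar.cons m (b i)) then h.choose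
        else ((M i).nonempty s).some)
      rw [hc, ih] at this
      obtain ⟨i, h₁, h₂⟩ := (this.and hn).exists
      rw [not_forall] at h₂
      rw [dif_pos h₂] at h₁
      exact h₂.choose_spec h₁
    · intro h m
      obtain ⟨m, rfl⟩ : ∃ m', ultraElem m' = m := ⟨_, Quotient.out_eq m⟩
      rw [hc, ih]
      filter_upwards [h] with i hi
      exact hi _

/-- Łoś's theorem. -/
theorem sat_ultraMk {V : L.Sorts → Type u} (a : ∀ i, Tuple V (M i).carrier) (ψ : Formula L V) :
    (ultraproduct U M).Sat ψ (ultraMk a) ↔ ∀ᶠ i in (U : Filter ι), (M i).Sat ψ (a i) := by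
  have := holds_ultraMk (U := U) a ψ fun i => BVar.nil
  rwa [BVar.eq_nil (ultraMk _)] at this

/-- `e` is an elementary embedding. -/
def IsElementary (M N : Struct L) (e : ∀ s, M.carrier s → N.carrier s) : Prop :=
  ∀ (V : L.Sorts → Type u) (a : Tuple V M.carrier), ElemEq M a N fun s v => e s (a s v)

theorem isElementary_diag (M : Struct L) :
    IsElementary M (ultraproduct U fun _ => M)
      fun _ m => ultraElem fun _ => m := by
  intro V a ψ
  refine Iff.symm ((sat_ultraMk (U := U) (M := fun _ => M) (fun _ => a) ψ).trans ?_)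
  simp

end Ultraproduct

/-- Every structure has an elementary extension realizing all finitely satisfiable sets of formulas
with parameters. -/
theorem exists_elementary_realizing (M : Struct L) (z : L.Sorts → Type u) :
    ∃ (N : Struct L) (e : ∀ s, M.carrier s → N.carrier s), IsElementary M N e ∧
      ∀ p : Set (Formula L (join z M.carrier)), FinSat M p (fun _ m => m) →
        ∃ c : Tuple z N.carrier, ∀ θ ∈ p, N.Sat θ (c.append e) := by
  classical
  -- Indexing by all finite sets of formulas, rather than by those inside one `p`, lets a single
  -- ultrapower realize every `p`.
  let U := Ultrafilter.of (Filter.atTop : Filter (Finset (Formula L (join z M.carrier))))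
  refine ⟨ultraproduct U fun _ => M, _, isElementary_diag M, fun p hp => ?_⟩
  choose c hc using fun F : Finset (Formula L (join z M.carrier)) =>
    hp (F.filter (· ∈ p)) (by simp [Set.subset_def])
  refine ⟨ultraMk c, fun θ hθ => ?_⟩
  have := sat_ultraMk (U := U) (M := fun _ => M)
    (fun F => (c F).append (fun s (m : M.carrier s) => m)) θ
  rw [← ultraMk_append] at this
  refine this.2 ?_
  have h : ∀ᶠ F in (U : Filter (Finset (Formula L (join z M.carrier)))), {θ} ≤ F :=
    Ultrafilter.of_le _ (Filter.eventually_ge_atTop _)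
  filter_upwards [h] with F hF
  exact hc F θ (by simpa [hθ] using hF)

/-- The compactness theorem, for a type over a structure. -/
theorem exists_realizing {z V : L.Sorts → Type u} (M : Struct L) (p : Set (Formula L (join z V)))
    (a : Tuple V M.carrier) (hp : FinSat M p a) :
    ∃ (N : Struct L) (b : Tuple V N.carrier), ElemEq M a N b ∧
      ∃ c : Tuple z N.carrier, ∀ θ ∈ p, N.Sat θ (c.append b) := by
  obtain ⟨N, e, he, h⟩ := exists_elementary_realizing M z
  obtain ⟨c, hc⟩ := h _ (FinSat.image (a := fun _ m => m) (fun _ => Function.injective_id) (g := a) hp)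
  refine ⟨N, _, he V a, c, fun θ hθ => ?_⟩
  have := hc _ ⟨θ, hθ, rfl⟩
  rwa [Struct.sat_relabel, Tuple.append_comp_sumMap] at this

theorem Struct.isPartialType_iff_finSat (M : Struct L) (A : M.Params) {z : L.Sorts → Type u}
    (p : Set (Formula L (join z A.ctx))) : M.IsPartialType A p ↔ FinSat M p A.incl := by
  constructor
  · rintro ⟨N, f, hf, c, hc⟩
    exact (FinSat.of_realize hc).transfer (ElemEq.of_imp hf).symm
  · intro h
    obtain ⟨N, f, hf, hc⟩ := exists_realizing M p A.incl h
    exact ⟨N, f, fun χ => (hf χ).1, hc⟩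

/-! ### Elementary chains -/

theorem IsElementary.comp {M N P : Struct L} {e : ∀ s, M.carrier s → N.carrier s}
    {f : ∀ s, N.carrier s → P.carrier s} (he : IsElementary M N e) (hf : IsElementary N P f) :
    IsElementary M P fun s m => f s (e s m) :=
  fun V a => (he V a).trans (hf V _)

/-- An upper bound of the chain suffices, so no direct limit is formed. In a nonprincipal
ultraproduct of the stages, `m` in stage `n` becomes the sequence of its images from index `n` on,
with arbitrary values before. -/
theorem exists_chain_limit (M : ℕ → Struct L)
    (e : ∀ n s, (M n).carrier s → (M (n + 1)).carrier s)
    (he : ∀ n, IsElementary (M n) (M (n + 1)) (e n)) :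
    ∃ (N : Struct L) (g : ∀ n s, (M n).carrier s → N.carrier s),
      (∀ n, IsElementary (M n) N (g n)) ∧ ∀ n s m, g (n + 1) s (e n s m) = g n s m := by
  classical
  let U : Ultrafilter (ULift.{u} ℕ) := (Filter.hyperfilter ℕ).map ULift.up
  have hU : ∀ n, ∀ᶠ i in (U : Filter (ULift.{u} ℕ)), n ≤ i.down := fun n =>
    Filter.mem_map.2 (Nat.hyperfilter_le_atTop (Filter.eventually_ge_atTop n))
  let f : ∀ {n k : ℕ}, n ≤ k → ∀ s, (M n).carrier s → (M k).carrier s := fun {n k} h s =>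
    Nat.leRecOn (C := fun k => (M k).carrier s) h (fun {k} => e k s)
  have hf : ∀ {n k : ℕ} (h : n ≤ k), IsElementary (M n) (M k) (f h) := by
    intro n k h
    induction k, h using Nat.le_induction with
    | base =>
      intro V a χ
      simp only [f, Nat.leRecOn_self]
    | succ k h ih =>
      have : f (h.trans (Nat.le_succ k)) = fun s m => e k s (f h s m) := by
        funext s m
        exact Nat.leRecOn_succ (C := fun k => (M k).carrier s) h m
      rw [this]
      exact ih.comp (he k)
  let r : ∀ n s, (M n).carrier s → ∀ i : ULift.{u} ℕ, (M i.down).carrier s := fun n s m i =>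
    if h : n ≤ i.down then f h s m else ((M i.down).nonempty s).some
  refine ⟨ultraproduct U fun i => M i.down, fun n s m => ultraElem (r n s m), ?_, ?_⟩
  · intro n V a χ
    refine Iff.symm ((sat_ultraMk (U := U) (M := fun i => M i.down)
      (fun i s v => r n s (a s v) i) χ).trans ?_)
    rw [← Filter.eventually_const (f := (U : Filter (ULift.{u} ℕ))) (p := (M n).Sat χ a)]
    refine Filter.eventually_congr ?_
    filter_upwards [hU n] with i hi
    simp only [r, hi, dite_true]
    exact (hf hi V a χ).symm
  · intro n s m
    refine ultraElem_eq_iff.2 ?_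
    filter_upwards [hU (n + 1)] with i hi
    have hi' : n ≤ i.down := (Nat.le_succ n).trans hi
    simp only [r, hi, hi', dite_true, f]
    exact Nat.leRecOn_succ_left (C := fun k => (M k).carrier s) (next := fun {k} => e k s) m hi' hi

/-! ### Saturated subsets -/

/-- Countably many variables of every sort. -/
abbrev natVars (L : Language.{u}) : L.Sorts → Type u := fun _ => ULift.{u} ℕ

/-- `D` contains realizations of all the finitely satisfiable sets of formulas, in countably many
variables of every sort, over the finite subsets of `D`. -/
def SaturatedIn (N : Struct L) (D : N.Params) : Prop :=
  ∀ A : N.Params, Finite (Σ s, A s) → (∀ s, A s ⊆ D s) →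
    ∀ p : Set (Formula L (join (natVars L) A.ctx)), FinSat N p A.incl →
      ∃ c : Tuple (natVars L) N.carrier,
        (∀ s v, c s v ∈ D s) ∧ ∀ θ ∈ p, N.Sat θ (c.append A.incl)

/-- Iterate the one-step extension `ω` times and let `D` be the union of the images of the stages. A
finite subset of `D` comes from one stage, and types over it are realized in the next. -/
theorem exists_elementary_saturatedIn (M : Struct L) :
    ∃ (N : Struct L) (e : ∀ s, M.carrier s → N.carrier s) (D : N.Params),
      IsElementary M N e ∧ (∀ s m, e s m ∈ D s) ∧ SaturatedIn N D := by
  choose E e he hE using fun M : Struct L => exists_elementary_realizing M (natVars L)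
  let M' : ℕ → Struct L := fun n => Nat.rec M (fun _ P => E P) n
  obtain ⟨N, g, hg, hge⟩ := exists_chain_limit M' (fun n => e (M' n)) (fun n => he (M' n))
  have hmono : ∀ {n k : ℕ}, n ≤ k → ∀ s, Set.range (g n s) ⊆ Set.range (g k s) := by
    intro n k h s
    induction k, h using Nat.le_induction with
    | base => exact subset_rfl
    | succ k h ih =>
      refine ih.trans ?_
      rintro _ ⟨m, rfl⟩
      exact ⟨_, hge k s m⟩
  refine ⟨N, g 0, fun s => ⋃ n, Set.range (g n s), hg 0,
    fun s m => Set.mem_iUnion.2 ⟨0, m, rfl⟩, fun A hA hAD p hp => ?_⟩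
  choose n hn using fun a : Σ s, A s => Set.mem_iUnion.1 (hAD a.1 a.2.2)
  obtain ⟨k, hk⟩ := (Set.finite_range n).bddAbove
  choose m hm using fun s (a : A s) => hmono (hk ⟨⟨s, a⟩, rfl⟩) s (hn ⟨s, a⟩)
  have hA' : A.incl = fun s v => g k s (m s v) := by
    funext s v; exact (hm s v).symm
  have hp' : FinSat (M' k) p m := by
    refine hp.transfer ?_
    rw [hA']
    exact (hg k _ m).symm
  obtain ⟨c, hc⟩ := hE (M' k) _
    (FinSat.image (a := fun _ m => m) (fun _ => Function.injective_id) (g := m) hp')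
  refine ⟨fun s v => g (k + 1) s (c s v), fun s v => Set.mem_iUnion.2 ⟨k + 1, _, rfl⟩,
    fun θ hθ => ?_⟩
  have h := hc _ ⟨θ, hθ, rfl⟩
  rw [Struct.sat_relabel, Tuple.append_comp_sumMap] at h
  have h' := (hg (k + 1) _ _ θ).1 h
  convert h' using 1
  funext s v
  cases v with
  | inl v => rfl
  | inr v => exact (congrFun (congrFun hA' s) v).trans (hge k s _).symm

/-- A finite context embeds in `natVars L`, and a tuple `d` with possible repetitions is replaced by
its range. -/
theorem SaturatedIn.exists_realize {N : Struct L} {D : N.Params} (h : SaturatedIn N D)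
    {z V : L.Sorts → Type u} (hz : Finite (Σ s, z s)) (hV : Finite (Σ s, V s))
    (d : Tuple V N.carrier) (hd : ∀ s v, d s v ∈ D s) (p : Set (Formula L (join z V)))
    (hp : FinSat N p d) :
    ∃ c : Tuple z N.carrier, (∀ s v, c s v ∈ D s) ∧ ∀ θ ∈ p, N.Sat θ (c.append d) := by
  obtain ⟨f, hf⟩ := exists_injective_nat (Σ s, z s)
  let A : N.Params := fun s => Set.range (d s)
  have hA : Finite (Σ s, A s) :=
    Finite.of_surjective (fun v : Σ s, V s => (⟨v.1, d v.1 v.2, v.2, rfl⟩ : Σ s, A s)) (by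
      rintro ⟨s, _, v, rfl⟩
      exact ⟨⟨s, v⟩, rfl⟩)
  obtain ⟨c, hcD, hc⟩ := h A hA (by rintro s _ ⟨v, rfl⟩; exact hd s v) _
    (FinSat.image (f := fun s v => (ULift.up (f ⟨s, v⟩) : natVars L s))
      (a := A.incl) (g := fun s v => (⟨d s v, v, rfl⟩ : A s))
      (fun s v v' e => by simpa using hf (ULift.up_injective e)) hp)
  refine ⟨fun s v => c s ⟨f ⟨s, v⟩⟩, fun s v => hcD s _, fun θ hθ => ?_⟩
  have := hc _ ⟨θ, hθ, rfl⟩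
  rw [Struct.sat_relabel, Tuple.append_comp_sumMap] at this
  exact this

/-- The substructure with a given closed universe. -/
def Struct.sub (N : Struct L) (D : N.Params) (hne : ∀ s, (D s).Nonempty)
    (hD : ∀ {l : List L.Sorts} {s : L.Sorts} (f : L.Functions l s)
      (xs : ∀ i : Fin l.length, N.carrier (l.get i)), (∀ i, xs i ∈ D (l.get i)) →
        N.funMap f xs ∈ D s) : Struct L where
  carrier s := D s
  nonempty s := (hne s).to_subtype
  funMap f xs := ⟨N.funMap f fun i => (xs i).1, hD f _ fun i => (xs i).2⟩
  relMap R xs := N.relMap R fun i => (xs i).1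

theorem SaturatedIn.nonempty {N : Struct L} {D : N.Params} (h : SaturatedIn N D) (s : L.Sorts) :
    (D s).Nonempty := by
  have hE : Finite (Σ s : L.Sorts, PEmpty.{u + 1}) :=
    Finite.of_injective (β := PEmpty.{1}) (nomatch ·.2) (nomatch ·.2)
  obtain ⟨c, hc, -⟩ := h.exists_realize (z := BVar [s]) (V := fun _ => PEmpty) (BVar.finite _) hE
    (fun _ v => nomatch v) (fun _ v => nomatch v) ∅
    (fun F hF => ⟨fun s _ => (N.nonempty s).some, fun θ hθ => absurd (hF hθ) id⟩)
  exact ⟨_, hc s .zero⟩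

/-- The value is the only realization of the formula `v = f(xs)`, whose parameters are finitely many
elements of `D`. -/
theorem SaturatedIn.funMap_mem {N : Struct L} {D : N.Params} (h : SaturatedIn N D)
    {l : List L.Sorts} {s : L.Sorts} (f : L.Functions l s)
    (xs : ∀ i : Fin l.length, N.carrier (l.get i)) (hxs : ∀ i, xs i ∈ D (l.get i)) :
    N.funMap f xs ∈ D s := by
  let V : L.Sorts → Type u := fun s => ULift {i : Fin l.length // l.get i = s}
  have hV : Finite (Σ s, V s) := Finite.of_injective (β := Fin l.length) (fun v => v.2.down.1) (by
    rintro ⟨_, ⟨i, rfl⟩⟩ ⟨_, ⟨j, rfl⟩⟩ hij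
    obtain rfl : i = j := hij
    rfl)
  let d : Tuple V N.carrier := fun s v => v.down.2 ▸ xs v.down.1
  let θ : Formula L (join (BVar [s]) V) :=
    .equal (.var (.inl (.inl .zero))) (.app f fun i => .var (.inl (.inr ⟨i, rfl⟩)))
  have hθ : ∀ c : Tuple (BVar [s]) N.carrier,
      N.Sat θ (c.append d) ↔ c s .zero = N.funMap f xs := fun c => Iff.rfl
  obtain ⟨c, hcD, hc⟩ := h.exists_realize (BVar.finite [s]) hV d (by
      rintro _ ⟨i, rfl⟩
      exact hxs i) {θ} (FinSat.of_realize (c := BVar.cons (N.funMap f xs) BVar.nil) (by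
        rintro _ rfl
        exact (hθ _).2 rfl))
  rw [← (hθ c).1 (hc θ rfl)]
  exact hcD _ _

/-- The elementary substructure on a saturated subset. -/
def SaturatedIn.struct {N : Struct L} {D : N.Params} (h : SaturatedIn N D) : Struct L :=
  N.sub D h.nonempty h.funMap_mem

/-- The inclusion of the elementary substructure on a saturated subset. -/
def SaturatedIn.val {N : Struct L} {D : N.Params} (h : SaturatedIn N D) (s : L.Sorts)
    (m : h.struct.carrier s) : N.carrier s :=
  Subtype.val (p := (· ∈ D s)) m

theorem SaturatedIn.val_injective {N : Struct L} {D : N.Params} (h : SaturatedIn N D)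
    (s : L.Sorts) : Function.Injective (h.val s) := Subtype.val_injective

theorem SaturatedIn.val_mem {N : Struct L} {D : N.Params} (h : SaturatedIn N D)
    {s : L.Sorts} (m : h.struct.carrier s) : h.val s m ∈ D s := Subtype.property _

theorem SaturatedIn.exists_val_eq {N : Struct L} {D : N.Params} (h : SaturatedIn N D)
    {V : L.Sorts → Type u} (c : Tuple V N.carrier) (hc : ∀ s v, c s v ∈ D s) :
    ∃ c' : Tuple V h.struct.carrier, (fun s v => h.val s (c' s v)) = c :=
  ⟨fun s v => ⟨c s v, hc s v⟩, rfl⟩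

theorem SaturatedIn.eval_struct {N : Struct L} {D : N.Params} (h : SaturatedIn N D)
    {V : L.Sorts → Type u} (a : Tuple V h.struct.carrier) {s : L.Sorts} (t : Term L V s) :
    h.val s (t.eval h.struct a) = t.eval N fun s v => h.val s (a s v) := by
  induction t with
  | var v => rfl
  | app f ts ih =>
    simp only [Term.eval, ← ih]
    rfl

theorem Tuple.map_append {M N V W : L.Sorts → Type u} (e : ∀ s, M s → N s) (a : Tuple V M)
    (b : Tuple W M) : (fun s v => e s (a.append b s v)) =
      Tuple.append (fun s v => e s (a s v)) (fun s v => e s (b s v)) := by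
  funext s v
  cases v <;> rfl

/-- Tarski–Vaught test: a counterexample in `N` to a universal formula realizes a type over finitely
many elements of `D`, so saturation provides one in `D`. This is why `V` is finite here;
`SaturatedIn.isElementary` removes the restriction by keeping only the free variables. -/
theorem SaturatedIn.holds_struct {N : Struct L} {D : N.Params} (h : SaturatedIn N D)
    {V : L.Sorts → Type u} (hV : Finite (Σ s, V s)) (a : Tuple V h.struct.carrier)
    {l : List L.Sorts} (ψ : BFormula L V l) (b : Tuple (BVar l) h.struct.carrier) :
    ψ.Holds h.struct a b ↔ ψ.Holds N (fun s v => h.val s (a s v)) (fun s v => h.val s (b s v)) := by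
  have hap : ∀ {l : List L.Sorts} (b : Tuple (BVar l) h.struct.carrier),
      (fun s v => h.val s (a.append b s v)) =
        Tuple.append (M := N.carrier) (fun s v => h.val s (a s v)) (fun s v => h.val s (b s v)) :=
    fun b => Tuple.map_append (h.val) a b
  have hcons : ∀ {l : List L.Sorts} {s : L.Sorts} (b : Tuple (BVar l) h.struct.carrier)
      (m : h.struct.carrier s), (fun s v => h.val s (BVar.cons m b s v)) =
        BVar.cons (M := N.carrier) (h.val _ m) (fun s v => h.val s (b s v)) := by
    intro l s b m
    funext t v
    cases v <;> rfl
  induction ψ with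
  | falsum => rfl
  | equal t₁ t₂ =>
    simp only [BFormula.Holds]
    rw [← (h.val_injective _).eq_iff, h.eval_struct, h.eval_struct, hap]
  | rel R ts =>
    simp only [BFormula.Holds]
    rw [← hap]
    simp only [← h.eval_struct]
    rfl
  | imp ψ θ ih₁ ih₂ => simp only [BFormula.Holds, ih₁, ih₂]
  | @all l s ψ ih =>
    simp only [BFormula.Holds, ih, hcons]
    refine ⟨fun H => ?_, fun H m => H _⟩
    by_contra hn
    rw [not_forall] at hn
    obtain ⟨m, hm⟩ := hn
    let ρ : ∀ t, join V (BVar (s :: l)) t → join (join (BVar [s]) (join V (BVar l))) (BVar []) t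
      | _, .inl v => .inl (.inr (.inl v))
      | _, .inr .zero => .inl (.inl .zero)
      | _, .inr (.succ w) => .inl (.inr (.inr w))
    let d : Tuple (join V (BVar l)) N.carrier := fun s v => h.val s (a.append b s v)
    have hρ : ∀ c : Tuple (BVar [s]) N.carrier,
        N.Sat (ψ.neg.rename ρ) (c.append d) ↔
          ¬ ψ.Holds N (fun s v => h.val s (a s v))
            (BVar.cons (M := N.carrier) (c s .zero) fun s v => h.val s (b s v)) := by
      intro c
      refine (BFormula.holds_rename N ψ.neg ρ _ _ (fun s v => h.val s (a s v))
        (BVar.cons (M := N.carrier) (c s .zero) fun s v => h.val s (b s v)) ?_).trans Iff.rfl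
      intro t v
      match t, v with
      | _, .inl v => rfl
      | _, .inr .zero => rfl
      | _, .inr (.succ w) => rfl
    have hfin : Finite (Σ t, join V (BVar l) t) := by
      have := BVar.finite l
      exact Finite.of_equiv _ (Equiv.sigmaSumDistrib V (BVar l)).symm
    obtain ⟨c, hcD, hc⟩ := h.exists_realize (BVar.finite [s]) hfin d (fun s v => h.val_mem _)
      {ψ.neg.rename ρ} (FinSat.of_realize (c := BVar.cons m BVar.nil) (by
        rintro _ rfl
        exact (hρ _).2 hm))
    obtain ⟨c, rfl⟩ := h.exists_val_eq c hcD
    exact (hρ _).1 (hc _ rfl) (H (c s .zero))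

theorem SaturatedIn.isElementary {N : Struct L} {D : N.Params} (h : SaturatedIn N D) :
    IsElementary h.struct N h.val := by
  intro V a χ
  obtain ⟨χ', hχ⟩ := BFormula.exists_relabel_eq
    (U := fun s => {v : V s // (⟨s, v⟩ : Σ s, V s) ∈ χ.fv}) (fun s => Subtype.val) χ
    (fun v hv => ⟨⟨v.2, hv⟩, rfl⟩)
  rw [← hχ, Struct.sat_relabel, Struct.sat_relabel]
  have := h.holds_struct (finite_subtype_context χ.finite_fv) (fun s v => a s v.1) χ' BVar.nil
  rwa [BVar.eq_nil fun s v => h.val s (BVar.nil s v)] at this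

theorem SaturatedIn.omegaSaturated {N : Struct L} {D : N.Params} (h : SaturatedIn N D) :
    h.struct.OmegaSaturated := by
  intro A hA z hz p hp
  rw [Struct.isPartialType_iff_finSat] at hp
  obtain ⟨c, hcD, hc⟩ := h.exists_realize hz hA (fun s v => h.val s (A.incl s v))
    (fun s v => h.val_mem _) p (hp.transfer (h.isElementary _ _))
  obtain ⟨c, rfl⟩ := h.exists_val_eq c hcD
  refine ⟨c, fun ψ hψ => ?_⟩
  rw [h.isElementary _ _ ψ, Tuple.map_append h.val]
  exact hc ψ hψ

/-! ### Counting formulas, and small saturated models -/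

section Cardinality

open Cardinal

/-- Negation is an injective operation on formulas that misses `⊥`. -/
theorem Language.aleph0_le_card (L : Language.{u}) : ℵ₀ ≤ L.card := by
  rw [Language.card, ← infinite_iff]
  by_contra h
  rw [not_infinite_iff_finite] at h
  have hinj : Function.Injective (fun ψ : Formula L (natVars L) => ψ.neg) := by
    intro ψ θ e
    simpa [BFormula.neg] using e
  obtain ⟨ψ, hψ⟩ := Finite.surjective_of_injective hinj .falsum
  simp [BFormula.neg] at hψ

/-- A variable is recovered from the formula `v = v`. In particular the number of sorts is at most
`|L|`. -/
theorem mk_natVars_le (L : Language.{u}) : #(Σ s, natVars L s) ≤ L.card := by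
  refine mk_le_of_injective
    (f := fun v => (.equal (.var (.inl v.2)) (.var (.inl v.2)) : Formula L (natVars L))) ?_
  rintro ⟨s, v⟩ ⟨s', v'⟩ h
  simp only [BFormula.equal.injEq] at h
  obtain ⟨rfl, h, -⟩ := h
  simpa using h

theorem mk_formula_le_of_countable {V : L.Sorts → Type u} (hV : ∀ s, Countable (V s)) :
    #(Formula L V) ≤ L.card := by
  choose f hf using fun s => exists_injective_nat (V s)
  exact mk_le_of_injective (BFormula.relabel_injective (g := fun s v => (⟨f s v⟩ : natVars L s))
    fun s => ULift.up_injective.comp (hf s))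

theorem mk_finset_le {α : Type u} {κ : Cardinal.{u}} (hκ : ℵ₀ ≤ κ) (h : #α ≤ κ) :
    #(Finset α) ≤ κ := by
  classical
  exact (mk_le_of_surjective List.toFinset_surjective).trans
    ((mk_list_le_max α).trans (max_le hκ h))

theorem mk_sigma_le_of_le {α : Type u} {β : α → Type u} {κ : Cardinal.{u}} (hκ : ℵ₀ ≤ κ)
    (h : #α ≤ κ) (h' : ∀ a, #(β a) ≤ κ) : #(Σ a, β a) ≤ κ := by
  rw [mk_sigma]
  refine (sum_le_sum _ (fun _ => κ) h').trans ?_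
  rw [sum_const']
  exact (mul_le_mul_left h κ).trans (mul_eq_self hκ).le

/-- A formula lies over one of at most `κ` finite subcontexts, and each of these carries at most
`|L|` formulas. -/
theorem mk_formula_le {V : L.Sorts → Type u} {κ : Cardinal.{u}} (hL : L.card ≤ κ)
    (hV : #(Σ s, V s) ≤ κ) : #(Formula L V) ≤ κ := by
  have hκ := L.aleph0_le_card.trans hL
  let U : Finset (Σ s, V s) → L.Sorts → Type u := fun F s => {v : V s // (⟨s, v⟩ : Σ s, V s) ∈ F}
  have hsurj : Function.Surjective
      (fun q : Σ F : Finset (Σ s, V s), Formula L (U F) =>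
        q.2.relabel fun s => (Subtype.val : U q.1 s → V s)) := by
    intro ψ
    obtain ⟨ψ', h⟩ := BFormula.exists_relabel_eq (U := U ψ.finite_fv.toFinset)
      (fun s => Subtype.val) ψ fun v hv => ⟨⟨v.2, by simpa using hv⟩, rfl⟩
    exact ⟨⟨_, ψ'⟩, h⟩
  refine (mk_le_of_surjective hsurj).trans
    (mk_sigma_le_of_le hκ (mk_finset_le hκ hV) fun F => ?_)
  refine (mk_formula_le_of_countable fun s => ?_).trans hL
  have : Finite (U F s) := Finite.of_injective (β := F) (fun v => ⟨⟨s, v.1⟩, v.2⟩) (by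
    intro v w h
    exact Subtype.ext (by simpa using h))
  exact Finite.to_countable

/-- The parameters belonging to a set of sorted elements. -/
def paramsOf {N : Struct L} (E : Set (Σ s, N.carrier s)) : N.Params := fun s => {m | ⟨s, m⟩ ∈ E}

theorem card_paramsOf {N : Struct L} (E : Set (Σ s, N.carrier s)) : (paramsOf E).card = #E :=
  mk_congr ⟨fun m => ⟨⟨m.1, m.2.1⟩, m.2.2⟩, fun m => ⟨m.1.1, m.1.2, m.2⟩, fun _ => rfl,
    fun _ => rfl⟩

/-- Close `A` off in `ω` steps: for every finite subset `F` and every set `p` of formulas over `F`,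
adjoin the coordinates of one realization. There are up to `2 ^ |L|` such `p` for each `F`, which is
where the lower bound on `κ` is used. -/
theorem SaturatedIn.exists_small {N : Struct L} {D : N.Params} (h : SaturatedIn N D)
    {κ : Cardinal.{u}} (hκ : 2 ^ L.card ≤ κ) (A : N.Params) (hAD : ∀ s, A s ⊆ D s)
    (hA : A.card ≤ κ) :
    ∃ B : N.Params, (∀ s, A s ⊆ B s) ∧ B.card ≤ κ ∧ SaturatedIn N B := by
  classical
  have hLκ : L.card ≤ κ := (cantor _).le.trans hκ
  have hω : ℵ₀ ≤ κ := L.aleph0_le_card.trans hLκ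
  -- Realizations are chosen for all pairs `(F, p)`, with a junk value when `p` is not a type over a
  -- finite subset of `D`; `step` meets the new elements with `D` so that junk cannot leave `D`.
  have hex : ∀ (F : N.Params) (p : Set (Formula L (join (natVars L) F.ctx))),
      ∃ c : Tuple (natVars L) N.carrier,
        Finite (Σ s, F s) ∧ (∀ s, F s ⊆ D s) ∧ FinSat N p F.incl →
          (∀ s v, c s v ∈ D s) ∧ ∀ θ ∈ p, N.Sat θ (c.append F.incl) := by
    intro F p
    by_cases H : Finite (Σ s, F s) ∧ (∀ s, F s ⊆ D s) ∧ FinSat N p F.incl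
    · obtain ⟨c, hc⟩ := h F H.1 H.2.1 p H.2.2
      exact ⟨c, fun _ => hc⟩
    · exact ⟨fun s _ => (N.nonempty s).some, fun H' => absurd H' H⟩
  choose c hc using hex
  let G : ∀ E : Set (Σ s, N.carrier s), Finset E → N.Params := fun E F =>
    paramsOf (Subtype.val '' (F : Set E))
  let R : Set (Σ s, N.carrier s) → Type u := fun E =>
    Σ F : Finset E, Set (Formula L (join (natVars L) (G E F).ctx)) × Σ s, natVars L s
  let step : Set (Σ s, N.carrier s) → Set (Σ s, N.carrier s) := fun E =>
    E ∪ ({m | m.2 ∈ D m.1} ∩ Set.range fun r : R E => ⟨r.2.2.1, c _ r.2.1 r.2.2.1 r.2.2.2⟩)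
  let E : ℕ → Set (Σ s, N.carrier s) := fun n => step^[n] {m | m.2 ∈ A m.1}
  have hE : ∀ n, E (n + 1) = step (E n) := fun n => Function.iterate_succ_apply' _ _ _
  have hGfin : ∀ E F, Finite (Σ s, G E F s) := fun E F =>
    finite_subtype_context (F.finite_toSet.image _)
  have hED : ∀ n, E n ⊆ {m | m.2 ∈ D m.1} := by
    intro n
    induction n with
    | zero => exact fun m hm => hAD _ hm
    | succ n ih =>
      rw [hE]
      exact Set.union_subset ih Set.inter_subset_left
  have hR : ∀ E : Set (Σ s, N.carrier s), #E ≤ κ → #(R E) ≤ κ := by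
    intro E hE
    refine mk_sigma_le_of_le hω (mk_finset_le hω hE) fun F => ?_
    rw [mk_prod, lift_id, lift_id]
    refine (mul_le_mul' ?_ ((mk_natVars_le L).trans hLκ)).trans (mul_eq_self hω).le
    rw [mk_set]
    refine (power_le_power_left two_ne_zero (mk_formula_le_of_countable fun s => ?_)).trans hκ
    have : Finite ((G E F).ctx s) := by
      have := hGfin E F
      exact Finite.of_injective (β := Σ s, G E F s) (fun m => ⟨s, m⟩) sigma_mk_injective
    infer_instance
  have hcard : ∀ n, #(E n) ≤ κ := by
    intro n
    induction n with
    | zero =>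
      refine le_of_eq_of_le ?_ hA
      exact (card_paramsOf {m : Σ s, N.carrier s | m.2 ∈ A m.1}).symm
    | succ n ih =>
      rw [hE]
      refine (mk_union_le _ _).trans ((add_le_add ih ?_).trans (add_eq_self hω).le)
      exact (mk_le_mk_of_subset Set.inter_subset_right).trans (mk_range_le.trans (hR _ ih))
  have hmono : Monotone E := monotone_nat_of_le_succ fun n => by
    rw [hE]; exact Set.subset_union_left
  refine ⟨paramsOf (⋃ n : ULift.{u} ℕ, E n.down),
    fun s m hm => Set.mem_iUnion.2 ⟨⟨0⟩, hm⟩, ?_, fun B hB hBE p hp => ?_⟩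
  · rw [card_paramsOf]
    refine (mk_iUnion_le_sum_mk).trans ((sum_le_sum _ (fun _ => κ) fun n => hcard _).trans ?_)
    rw [sum_const']
    refine (mul_le_mul_left ?_ κ).trans (mul_eq_self hω).le
    simpa using hω
  · choose n hn using fun b : Σ s, B s => Set.mem_iUnion.1 (hBE b.1 b.2.2)
    obtain ⟨k, hk⟩ := (Set.finite_range fun b => (n b).down).bddAbove
    have hBk : ∀ b : Σ s, B s, (⟨b.1, b.2.1⟩ : Σ s, N.carrier s) ∈ E k :=
      fun b => hmono (hk ⟨b, rfl⟩) (hn b)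
    obtain ⟨F, rfl⟩ : ∃ F : Finset (E k), G (E k) F = B := by
      refine ⟨(Set.finite_range fun b => (⟨_, hBk b⟩ : E k)).toFinset, ?_⟩
      funext s
      ext m
      simp only [G, paramsOf, Set.mem_ofPred_eq, Set.mem_image, Set.Finite.coe_toFinset,
        Set.mem_range]
      constructor
      · rintro ⟨_, ⟨b, rfl⟩, hb⟩
        simp only [Sigma.mk.injEq] at hb
        obtain ⟨rfl, hb⟩ := hb
        rw [heq_eq_eq] at hb
        exact hb ▸ b.2.2
      · intro hm
        exact ⟨⟨_, hBk ⟨s, m, hm⟩⟩, ⟨_, rfl⟩, rfl⟩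
    have H : Finite (Σ s, G (E k) F s) ∧ (∀ s, G (E k) F s ⊆ D s) ∧
        FinSat N p (G (E k) F).incl :=
      ⟨hB, fun s m hm => hED k (hBk ⟨s, m, hm⟩), hp⟩
    refine ⟨c _ p, fun s v => Set.mem_iUnion.2 ⟨⟨k + 1⟩, ?_⟩, (hc _ p H).2⟩
    change _ ∈ E (k + 1)
    rw [hE]
    exact Or.inr ⟨(hc _ p H).1 s v, ⟨F, p, s, v⟩, rfl⟩

/-- Small sets of parameters embed elementarily in small `ω`-saturated models. -/
theorem exists_omegaSaturated (M : Struct L) (A : M.Params) {κ : Cardinal.{u}}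
    (hκ : 2 ^ L.card ≤ κ) (hA : A.card ≤ κ) :
    ∃ (N : Struct L) (f : Tuple A.ctx N.carrier), N.OmegaSaturated ∧ ElemEq M A.incl N f ∧
      #(Σ s, N.carrier s) ≤ κ := by
  obtain ⟨N, e, D, he, heD, hD⟩ := exists_elementary_saturatedIn M
  obtain ⟨B, hAB, hB, hBs⟩ := hD.exists_small hκ (fun s => e s '' A s)
    (by rintro s _ ⟨m, -, rfl⟩; exact heD s m) (by
      refine le_trans (mk_le_of_surjective (f := fun m : Σ s, A s =>
        (⟨m.1, e m.1 m.2.1, m.2.1, m.2.2, rfl⟩ : Σ s, (e s '' A s : Set _))) ?_) hA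
      rintro ⟨s, _, m, hm, rfl⟩
      exact ⟨⟨s, m, hm⟩, rfl⟩)
  obtain ⟨f, hf⟩ := hBs.exists_val_eq (V := A.ctx) (fun s m => e s m.1)
    fun s m => hAB s ⟨m.1, m.2, rfl⟩
  refine ⟨hBs.struct, f, hBs.omegaSaturated, ?_, hB⟩
  have h₁ := hBs.isElementary A.ctx f
  rw [hf] at h₁
  exact (he A.ctx A.incl).trans h₁.symm

end Cardinality

/-! ### Complete theories -/

theorem Struct.Models.of_elemEq {T : Set (Sentence L)} {M N : Struct L} {V : L.Sorts → Type u}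
    {a : Tuple V M.carrier} {b : Tuple V N.carrier} (hM : M.Models T) (h : ElemEq M a N b) :
    N.Models T := by
  intro χ hχ
  have := (h (χ.relabel fun _ v => nomatch v)).1 (by
    rw [Struct.sat_relabel]
    convert hM χ hχ using 1
    funext s v
    cases v)
  rw [Struct.sat_relabel] at this
  convert this using 1
  funext s v
  cases v

/-- The full theory of `M` is satisfiable and contains `T`, so by maximality it is contained in `T`.
-/
theorem IsComplete.elemEq {T : Set (Sentence L)} (hT : IsComplete T) {M N : Struct L}
    (hM : M.Models T) (hN : N.Models T) :
    ElemEq (V := fun _ => PEmpty) M (fun _ v => nomatch v) N (fun _ v => nomatch v) := by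
  refine ElemEq.of_imp fun χ hχ => hN χ ?_
  exact hT.2 (y := {χ | M.Sat χ fun _ v => nomatch v}) ⟨M, fun χ h => h⟩ (fun χ h => hM χ h) hχ

/-! ### Ideal schemas -/

section Ideals

variable {x y : L.Sorts → Type u} {I : Preschema L x} {T : Set (Sentence L)}

/-- Membership in `I(M)` quantifies over all presentations of a set; invariance makes any one of
them decisive. -/
theorem Preschema.IsIdealSchema.points_notMem_iff (hI : I.IsIdealSchema T) {M : Struct L}
    (hM : M.Models T) {V : L.Sorts → Type u} (ψ : Formula L (join x V)) (c : Tuple V M.carrier) :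
    M.points ψ c ∉ I.idealPoints M ↔ I.NotI M ψ c := by
  constructor
  · intro h
    by_contra h'
    exact h ⟨V, ψ, c, rfl, h'⟩
  · rintro h ⟨W, θ, d, hd, hn⟩
    exact hn (((hI M hM).1 _ _ _ _ _ _ hd).2 h)

theorem Preschema.IsIdealSchema.points_notMem_congr (hI : I.IsIdealSchema T) {M N : Struct L}
    (hM : M.Models T) {V : L.Sorts → Type u} (ψ : Formula L (join x V)) {c : Tuple V M.carrier}
    {d : Tuple V N.carrier} (h : ElemEq M c N d) :
    M.points ψ c ∉ I.idealPoints M ↔ N.points ψ d ∉ I.idealPoints N := by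
  rw [hI.points_notMem_iff hM, hI.points_notMem_iff (hM.of_elemEq h)]
  exact forall₂_congr fun θ _ => h θ

theorem Preschema.IsIdealSchema.notMem_mono (hI : I.IsIdealSchema T) {M : Struct L}
    (hM : M.Models T) {D E : Set (Tuple x M.carrier)} (hD : D ∈ M.Def x) (hDE : D ⊆ E)
    (h : D ∉ I.idealPoints M) : E ∉ I.idealPoints M :=
  fun hE => h ((hI M hM).2.mem_of_subset E hE D hD hDE)

theorem Struct.points_mem_Def (M : Struct L) {V : L.Sorts → Type u} (ψ : Formula L (join x V))
    (c : Tuple V M.carrier) : M.points ψ c ∈ M.Def x := ⟨V, ψ, c, rfl⟩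

/-- The set defined by `φ(x, c) ^ t`. -/
def cell (φ : Formula L (join x y)) (M : Struct L) (c : Tuple y M.carrier) (t : Bool) :
    Set (Tuple x M.carrier) := {a | M.Sat φ (a.append c) ↔ t = true}

/-- The rank, as a predicate on definable sets. -/
def WideRankGE (I : Preschema L x) (φ : Formula L (join x y)) (M : Struct L) :
    ℕ → Set (Tuple x M.carrier) → Prop
  | 0, D => D ∉ I.idealPoints M
  | n + 1, D => ∃ c : Tuple y M.carrier, ∀ t : Bool, WideRankGE I φ M n (D ∩ cell φ M c t)

theorem Struct.points_conj (M : Struct L) {V : L.Sorts → Type u} (ψ θ : Formula L (join x V))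
    (c : Tuple V M.carrier) : M.points (ψ.conj θ) c = M.points ψ c ∩ M.points θ c := by
  ext a
  simp [Struct.points]

theorem Struct.points_inst_pow (M : Struct L) {V : L.Sorts → Type u} (φ : Formula L (join x y))
    (b : Tuple y V) (t : Bool) (c : Tuple V M.carrier) :
    M.points ((φ.inst b).pow t) c = cell φ M (fun s v => c s (b s v)) t := by
  ext a
  simp only [Struct.points, Set.mem_ofPred_eq, Struct.sat_pow, Struct.sat_inst, cell]

theorem Struct.points_relabel (M : Struct L) {V W : L.Sorts → Type u} (ψ : Formula L (join x V))
    (g : ∀ s, V s → W s) (c : Tuple W M.carrier) :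
    M.points (ψ.relabel fun s => Sum.map id (g s)) c = M.points ψ fun s v => c s (g s v) := by
  ext a
  simp only [Struct.points, Set.mem_ofPred_eq, Struct.sat_relabel]
  rw [Tuple.append_comp_sumMap (fun _ => id)]
  rfl

theorem rankGE_iff (I : Preschema L x) (φ : Formula L (join x y)) (M : Struct L) (n : ℕ)
    (ψ : Formula L (join x M.carrier)) :
    RankGE I φ M n ψ ↔ WideRankGE I φ M n (M.points ψ fun _ m => m) := by
  induction n generalizing ψ with
  | zero => rfl
  | succ n ih =>
    simp only [RankGE, WideRankGE, ih, Struct.points_conj, Struct.points_inst_pow]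

theorem points_verum (M : Struct L) {V : L.Sorts → Type u} (c : Tuple V M.carrier) :
    M.points (x := x) .verum c = Set.univ := by
  ext a
  simp [Struct.points]

theorem rank_lt_top_iff (I : Preschema L x) (φ : Formula L (join x y)) (M : Struct L) :
    rank I φ M .verum < ⊤ ↔ ¬ ∀ n, WideRankGE I φ M n Set.univ := by
  have h : ∀ n, WideRankGE I φ M n Set.univ ↔ RankGE I φ M n .verum := fun n => by
    rw [rankGE_iff, points_verum]
  simp only [h, rank]
  split_ifs with h₁ h₂
  · simp only [bot_lt_top, true_iff]
    exact fun hn => hn 0 h₁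
  · simpa using h₂
  · simp only [h₂, not_false_eq_true, iff_true]
    exact WithBot.coe_lt_coe.2 (ENat.natCast_lt_top _)

/-- The formula `ψ(x, d) ∧ φ(x, c) ^ t`. -/
def splitFormula {V : L.Sorts → Type u} (ψ : Formula L (join x V)) (φ : Formula L (join x y))
    (t : Bool) : Formula L (join x (join V y)) :=
  BFormula.conj (ψ.relabel fun s => Sum.map id (Sum.inl : V s → V s ⊕ y s))
    ((φ.inst fun _ v => Sum.inr v).pow t)

theorem points_splitFormula (M : Struct L) {V : L.Sorts → Type u} (ψ : Formula L (join x V))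
    (φ : Formula L (join x y)) (t : Bool) (d : Tuple V M.carrier) (c : Tuple y M.carrier) :
    M.points (splitFormula ψ φ t) (d.append c) = M.points ψ d ∩ cell φ M c t := by
  have h := M.points_relabel ψ (W := join V y) (fun s => Sum.inl) (d.append c)
  rw [splitFormula, Struct.points_conj, Struct.points_inst_pow, h]
  rfl

/-- Variables for a tuple `y` and tuples `z t`, `t = 0, 1`. -/
abbrev splitVars (y : L.Sorts → Type u) (z : Bool → L.Sorts → Type u) : L.Sorts → Type u :=
  fun s => y s ⊕ Σ t : Bool, z t s

theorem finite_splitVars (hy : Finite (Σ s, y s)) {z : Bool → L.Sorts → Type u}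
    (hz : ∀ t, Finite (Σ s, z t s)) : Finite (Σ s, splitVars y z s) := by
  have : Finite (Σ s, Σ t : Bool, z t s) := Finite.of_surjective
    (fun v : Σ t : Bool, Σ s, z t s => (⟨v.2.1, v.1, v.2.2⟩ : Σ s, Σ t : Bool, z t s)) (by
      rintro ⟨s, t, v⟩; exact ⟨⟨t, s, v⟩, rfl⟩)
  exact Finite.of_equiv _ (Equiv.sigmaSumDistrib y fun s => Σ t : Bool, z t s).symm

/-- The inclusion of the variables `y`, `z t` and `V`. -/
def splitRename (y : L.Sorts → Type u) (z : Bool → L.Sorts → Type u) (V : L.Sorts → Type u)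
    (t : Bool) : ∀ s, join (z t) (join V y) s → join (splitVars y z) V s
  | _, .inl v => .inl (.inr ⟨t, v⟩)
  | _, .inr (.inl v) => .inr v
  | _, .inr (.inr v) => .inl (.inl v)

theorem append_comp_splitRename {z : Bool → L.Sorts → Type u} {V M : L.Sorts → Type u}
    (t : Bool) (c : Tuple (splitVars y z) M) (d : Tuple V M) :
    (fun s v => c.append d s (splitRename y z V t s v)) =
      Tuple.append (fun s v => c s (.inr ⟨t, v⟩)) (d.append fun s v => c s (.inl v)) := by
  funext s v
  rcases v with v | v | v <;> rfl

/-- The rank is type-definable, up to quantification over finitely many variables. -/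
theorem wideRankGE_typeDefinable (hI : I.IsIdealSchema T) (hy : Finite (Σ s, y s))
    (φ : Formula L (join x y)) (n : ℕ) (V : L.Sorts → Type u) (ψ : Formula L (join x V)) :
    ∃ (z : L.Sorts → Type u) (Γ : Set (Formula L (join z V))), Finite (Σ s, z s) ∧
      ∀ M : Struct L, M.Models T → ∀ d : Tuple V M.carrier,
        WideRankGE I φ M n (M.points ψ d) ↔
          ∃ c : Tuple z M.carrier, ∀ θ ∈ Γ, M.Sat θ (c.append d) := by
  induction n generalizing V with
  | zero =>
    -- At rank `0` the set `¬I x.ψ` is itself the type, with no auxiliary variables.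
    refine ⟨fun _ => PEmpty, (fun θ => θ.relabel fun s => Sum.inr) '' I.notI ψ,
      Finite.of_injective (β := PEmpty.{1}) (nomatch ·.2) (nomatch ·.2), fun M hM d => ?_⟩
    refine (hI.points_notMem_iff hM ψ d).trans ?_
    constructor
    · intro h
      refine ⟨fun s v => (nomatch v), ?_⟩
      rintro _ ⟨θ, hθ, rfl⟩
      rw [Struct.sat_relabel]
      exact h θ hθ
    · rintro ⟨c, hc⟩ θ hθ
      have := hc _ ⟨θ, hθ, rfl⟩
      rw [Struct.sat_relabel] at this
      exact this
  | succ n ih =>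
    choose z Γ hz hΓ using fun t : Bool => ih (join V y)
      (splitFormula ψ φ t)
    -- The splitting parameter and the witnesses for the two halves become one finite tuple of
    -- variables, and the two types are merged.
    refine ⟨splitVars y z, ⋃ t, (fun θ => θ.relabel (splitRename y z V t)) '' Γ t,
      finite_splitVars hy hz, fun M hM d => ?_⟩
    simp only [WideRankGE, ← points_splitFormula, hΓ _ M hM]
    constructor
    · rintro ⟨c, hc⟩
      choose b hb using hc
      refine ⟨fun s => Sum.elim (c s) fun v => b v.1 s v.2, ?_⟩
      intro θ' hθ'
      obtain ⟨t, θ, hθ, rfl⟩ := Set.mem_iUnion.1 hθ'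
      rw [Struct.sat_relabel, append_comp_splitRename]
      exact hb t θ hθ
    · rintro ⟨c, hc⟩
      refine ⟨fun s v => c s (.inl v), fun t => ⟨fun s v => c s (.inr ⟨t, v⟩), fun θ hθ => ?_⟩⟩
      have := hc _ (Set.mem_iUnion.2 ⟨t, θ, hθ, rfl⟩)
      rwa [Struct.sat_relabel, append_comp_splitRename] at this

/-- The rank of a set does not decrease in an `ω`-saturated model. -/
theorem WideRankGE.transfer (hT : IsComplete T) (hI : I.IsIdealSchema T) (hy : Finite (Σ s, y s))
    {φ : Formula L (join x y)} {M N : Struct L} (hM : M.Models T) (hN : N.Models T)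
    (hNs : N.OmegaSaturated) {n : ℕ} (h : WideRankGE I φ M n Set.univ) :
    WideRankGE I φ N n Set.univ := by
  -- Over no parameters, completeness of `T` makes the type from `M` finitely satisfiable in `N`,
  -- and saturation realizes it.
  let A : N.Params := fun _ => ∅
  obtain ⟨z, Γ, hz, hΓ⟩ := wideRankGE_typeDefinable hI hy φ n A.ctx .verum
  have hMN : ElemEq (V := A.ctx) M (fun _ v => absurd v.2 id) N A.incl := by
    convert (hT.elemEq hM hN).comp (W := A.ctx) fun _ v => absurd v.2 id using 1
    · funext s v; exact absurd v.2 id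
    · funext s v; exact absurd v.2 id
  rw [← points_verum M (V := A.ctx) fun _ v => absurd v.2 id, hΓ M hM] at h
  rw [← points_verum N A.incl, hΓ N hN]
  obtain ⟨c, hc⟩ := h
  refine hNs A (Finite.of_injective (β := PEmpty.{1}) (fun v => absurd v.2.2 id)
    (fun v => absurd v.2.2 id)) z hz Γ ?_
  rw [Struct.isPartialType_iff_finSat]
  exact (FinSat.of_realize hc).transfer hMN

/-! ### Binary trees -/

/-- The intersection of the cells along a finite path in a binary tree of parameters. -/
def pathSet (φ : Formula L (join x y)) (M : Struct L) :
    (List Bool → Tuple y M.carrier) → List Bool → Set (Tuple x M.carrier)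
  | _, [] => Set.univ
  | b, t :: s => cell φ M (b []) t ∩ pathSet φ M (fun r => b (t :: r)) s

/-- The successive choices of splitting parameters assemble into a tree of parameters; only its
nodes of length less than `n` matter. -/
theorem wideRankGE_iff_pathSet (I : Preschema L x) (φ : Formula L (join x y)) (M : Struct L)
    (n : ℕ) (D : Set (Tuple x M.carrier)) :
    WideRankGE I φ M n D ↔ ∃ b : List Bool → Tuple y M.carrier,
      ∀ s : List Bool, s.length = n → D ∩ pathSet φ M b s ∉ I.idealPoints M := by
  induction n generalizing D with
  | zero =>
    simp only [WideRankGE, List.length_eq_zero_iff, forall_eq, pathSet, Set.inter_univ]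
    exact ⟨fun h => ⟨fun _ s _ => (M.nonempty s).some, h⟩, fun ⟨_, h⟩ => h⟩
  | succ n ih =>
    simp only [WideRankGE, ih]
    constructor
    · rintro ⟨c, hc⟩
      choose b hb using hc
      refine ⟨fun s => s.casesOn c fun t r => b t r, fun s hs => ?_⟩
      cases s with
      | nil => simp at hs
      | cons t r =>
        have := hb t r (by simpa using hs)
        rwa [Set.inter_assoc] at this
    · rintro ⟨b, hb⟩
      refine ⟨b [], fun t => ⟨fun r => b (t :: r), fun s hs => ?_⟩⟩
      have := hb (t :: s) (by simpa using hs)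
      rwa [pathSet, ← Set.inter_assoc] at this

theorem restr_succ (σ : ℕ → Bool) (n : ℕ) :
    restr σ (n + 1) = σ 0 :: restr (fun i => σ (i + 1)) n := by
  simp [restr, List.ofFn_succ]

theorem pathSet_restr (φ : Formula L (join x y)) (M : Struct L)
    (b : List Bool → Tuple y M.carrier) (σ : ℕ → Bool) (n : ℕ) :
    pathSet φ M b (restr σ n) = {a | ∀ i < n, a ∈ cell φ M (b (restr σ i)) (σ i)} := by
  induction n generalizing b σ with
  | zero => simp [restr, pathSet]
  | succ n ih =>
    rw [restr_succ, pathSet, ih]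
    ext a
    simp only [Set.mem_inter_iff, Set.mem_ofPred_eq]
    constructor
    · rintro ⟨h₀, h⟩ i hi
      cases i with
      | zero => exact h₀
      | succ i => rw [restr_succ]; exact h i (by omega)
    · intro h
      refine ⟨h 0 (by omega), fun i hi => ?_⟩
      have := h (i + 1) (by omega)
      rwa [restr_succ] at this

theorem points_branchFormula (φ : Formula L (join x y)) (M : Struct L)
    (b : Tuple (treeCtx y) M.carrier) (σ : ℕ → Bool) (K : Finset ℕ) :
    M.points (branchFormula φ σ K) b =
      {a | ∀ n ∈ K, a ∈ cell φ M (fun s v => b s (restr σ n, v)) (σ n)} := by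
  ext a
  simp only [branchFormula, Struct.points, Set.mem_ofPred_eq, Struct.sat_conj, Struct.sat_verum,
    Struct.sat_bigConj, List.mem_map, Finset.mem_sort, forall_exists_index, and_imp,
    forall_apply_eq_imp_iff₂, true_and, Struct.sat_pow, treeInst, Struct.sat_inst, cell]

theorem Preschema.IsIdealSchema.sat_tree_iff (hI : I.IsIdealSchema T) {M : Struct L}
    (hM : M.Models T) (φ : Formula L (join x y)) (b : Tuple (treeCtx y) M.carrier) :
    (∀ θ ∈ Tree I φ, M.Sat θ b) ↔ ∀ (σ : ℕ → Bool) (K : Finset ℕ),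
      {a | ∀ n ∈ K, a ∈ cell φ M (fun s v => b s (restr σ n, v)) (σ n)} ∉ I.idealPoints M := by
  simp only [← points_branchFormula, hI.points_notMem_iff hM]
  constructor
  · intro h σ K θ hθ
    exact h θ ⟨σ, K, hθ⟩
  · rintro h θ ⟨σ, K, hθ⟩
    exact h σ K θ hθ

theorem WideRankGE.of_tree (hI : I.IsIdealSchema T) {M : Struct L} (hM : M.Models T)
    {φ : Formula L (join x y)} {b : Tuple (treeCtx y) M.carrier}
    (h : ∀ θ ∈ Tree I φ, M.Sat θ b) (n : ℕ) : WideRankGE I φ M n Set.univ := by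
  rw [hI.sat_tree_iff hM] at h
  rw [wideRankGE_iff_pathSet]
  refine ⟨fun r s v => b s (r, v), fun s hs => ?_⟩
  -- The finite path is padded by `false` to an infinite branch; only the first `n` values are used.
  let σ : ℕ → Bool := fun i => s.getD i false
  have hσ : restr σ n = s := by
    subst hs
    refine List.ext_getElem (by simp [restr]) fun i h₁ h₂ => ?_
    simp [restr, σ]
  rw [← hσ, Set.univ_inter, pathSet_restr]
  simpa using h σ (Finset.range n)

/-- Finitely many formulas of the tree look at finitely many levels, and a wide tree of larger
finite height satisfies them. -/
theorem consistentWith_tree (hI : I.IsIdealSchema T) {M : Struct L} (hM : M.Models T)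
    {φ : Formula L (join x y)} (h : ∀ n, WideRankGE I φ M n Set.univ) :
    ConsistentWith T (Tree I φ) := by
  classical
  let Γ : Set (Formula L (join (treeCtx y) fun _ => PEmpty)) :=
    (fun θ => θ.relabel fun _ => Sum.inl) '' Tree I φ
  obtain ⟨N, d, hd, b, hb⟩ := exists_realizing M Γ (fun _ v => nomatch v) (by
    intro F hF
    obtain ⟨F, hF', rfl⟩ := Finset.subset_set_image_iff.1 hF
    have hF'' : ∀ θ ∈ F, ∃ σ K, θ ∈ I.notI (branchFormula φ σ K) := fun θ h => hF' h
    choose! σ K hK using hF''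
    -- The added one puts every level that occurs strictly below `n`.
    let n := (F.biUnion K).sup id + 1
    obtain ⟨b, hb⟩ := (wideRankGE_iff_pathSet I φ M n _).1 (h n)
    refine ⟨fun s v => b v.1 s v.2, fun θ' hθ' => ?_⟩
    obtain ⟨θ, hθ, rfl⟩ := Finset.mem_image.1 hθ'
    rw [Struct.sat_relabel]
    refine (hI.points_notMem_iff hM (branchFormula φ (σ θ) (K θ)) fun s v => b v.1 s v.2).1 ?_ θ
      (hK θ hθ)
    have hwide := hb (restr (σ θ) n) List.length_ofFn
    rw [Set.univ_inter, pathSet_restr] at hwide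
    have e := points_branchFormula φ M (fun s v => b v.1 s v.2) (σ θ) (Finset.range n)
    simp only [Finset.mem_range] at e
    rw [← e] at hwide
    -- Using only the levels in `K` imposes fewer conditions than the whole path, and supersets of
    -- wide sets are wide.
    refine hI.notMem_mono hM (M.points_mem_Def _ _) ?_ hwide
    rw [e, points_branchFormula]
    intro a ha i hi
    exact ha i (Nat.lt_succ_of_le (Finset.le_sup (f := id) (Finset.mem_biUnion.2 ⟨θ, hθ, hi⟩))))
  refine ⟨N, hM.of_elemEq hd, b, fun θ hθ => ?_⟩
  have := hb _ ⟨θ, hθ, rfl⟩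
  rwa [Struct.sat_relabel] at this

end Ideals

/-! ### Complete `φ`-types -/

section Types

variable {x y : L.Sorts → Type u} {φ : Formula L (join x y)} {M : Struct L} {A : M.Params}

theorem IsPhiFormula.neg {ψ : Formula L (join x A.ctx)} (h : IsPhiFormula φ A ψ) :
    IsPhiFormula φ A ψ.neg := .imp h .falsum

theorem IsPhiFormula.conj {ψ θ : Formula L (join x A.ctx)} (h : IsPhiFormula φ A ψ)
    (h' : IsPhiFormula φ A θ) : IsPhiFormula φ A (ψ.conj θ) := .neg (.imp h h'.neg)

theorem IsPhiFormula.bigConj {ψs : List (Formula L (join x A.ctx))}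
    (h : ∀ ψ ∈ ψs, IsPhiFormula φ A ψ) : IsPhiFormula φ A (BFormula.bigConj ψs) := by
  induction ψs with
  | nil => exact .neg .falsum
  | cons ψ ψs ih =>
    exact .conj (h ψ List.mem_cons_self) (ih fun θ hθ => h θ (List.mem_cons_of_mem _ hθ))

theorem IsPhiFormula.pow {ψ : Formula L (join x A.ctx)} (h : IsPhiFormula φ A ψ) (t : Bool) :
    IsPhiFormula φ A (ψ.pow t) := by
  cases t
  · exact h.neg
  · exact h

variable (φ) in
/-- The complete `φ`-type of a tuple. -/
def phiTypeOf (A : M.Params) (N : Struct L) (f : Tuple A.ctx N.carrier) (c : Tuple x N.carrier) :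
    Set (Formula L (join x A.ctx)) := {ψ | IsPhiFormula φ A ψ ∧ N.Sat ψ (c.append f)}

/-- Maximality holds because a tuple satisfies every `φ`-formula or its negation. -/
theorem phiTypeOf_mem_phiTypes {N : Struct L} {f : Tuple A.ctx N.carrier}
    (hf : ElemEq M A.incl N f) (c : Tuple x N.carrier) : phiTypeOf φ A N f c ∈ phiTypes φ M A := by
  refine ⟨⟨fun ψ h => h.1, N, f, fun χ => (hf χ).1, c, fun ψ h => h.2⟩, ?_⟩
  rintro q ⟨hq, N', f', -, c', hc'⟩ hpq ψ hψ
  refine ⟨hq ψ hψ, ?_⟩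
  by_contra hn
  exact hc' _ (hpq ⟨(hq ψ hψ).neg, hn⟩) (hc' ψ hψ)

/-- Replacing a complete type by a realization reduces its Boolean closure properties to the
semantics of connectives. -/
theorem exists_eq_phiTypeOf {p : Set (Formula L (join x A.ctx))} (hp : p ∈ phiTypes φ M A) :
    ∃ (N : Struct L) (f : Tuple A.ctx N.carrier) (c : Tuple x N.carrier),
      ElemEq M A.incl N f ∧ p = phiTypeOf φ A N f c := by
  obtain ⟨⟨hp, N, f, hf, c, hc⟩, hmax⟩ := hp
  have h : p ⊆ phiTypeOf φ A N f c := fun ψ hψ => ⟨hp ψ hψ, hc ψ hψ⟩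
  exact ⟨N, f, c, .of_imp hf, h.antisymm (hmax (phiTypeOf_mem_phiTypes (.of_imp hf) c).1 h)⟩

theorem isPhiFormula_of_mem {p : Set (Formula L (join x A.ctx))} (hp : p ∈ phiTypes φ M A)
    {ψ : Formula L (join x A.ctx)} (h : ψ ∈ p) : IsPhiFormula φ A ψ := hp.1.1 ψ h

theorem falsum_notMem_phiType {p : Set (Formula L (join x A.ctx))} (hp : p ∈ phiTypes φ M A) :
    BFormula.falsum ∉ p := by
  obtain ⟨N, f, c, hf, rfl⟩ := exists_eq_phiTypeOf hp
  exact fun h => h.2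

theorem imp_mem_phiType_iff {p : Set (Formula L (join x A.ctx))} (hp : p ∈ phiTypes φ M A)
    {ψ θ : Formula L (join x A.ctx)} (hψ : IsPhiFormula φ A ψ) (hθ : IsPhiFormula φ A θ) :
    BFormula.imp ψ θ ∈ p ↔ (ψ ∈ p → θ ∈ p) := by
  obtain ⟨N, f, c, hf, rfl⟩ := exists_eq_phiTypeOf hp
  exact ⟨fun h h' => ⟨hθ, h.2 h'.2⟩, fun h => ⟨.imp hψ hθ, fun h' => (h ⟨hψ, h'⟩).2⟩⟩

theorem neg_mem_phiType_iff {p : Set (Formula L (join x A.ctx))} (hp : p ∈ phiTypes φ M A)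
    {ψ : Formula L (join x A.ctx)} (hψ : IsPhiFormula φ A ψ) : ψ.neg ∈ p ↔ ψ ∉ p := by
  rw [BFormula.neg, imp_mem_phiType_iff hp hψ .falsum]
  simp [falsum_notMem_phiType hp]

theorem conj_mem_phiType {p : Set (Formula L (join x A.ctx))} (hp : p ∈ phiTypes φ M A)
    {ψ θ : Formula L (join x A.ctx)} (hψ : ψ ∈ p) (hθ : θ ∈ p) : ψ.conj θ ∈ p := by
  obtain ⟨N, f, c, hf, rfl⟩ := exists_eq_phiTypeOf hp
  exact ⟨.conj hψ.1 hθ.1, (N.sat_conj _ _ _).2 ⟨hψ.2, hθ.2⟩⟩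

theorem bigConj_mem_phiType {p : Set (Formula L (join x A.ctx))} (hp : p ∈ phiTypes φ M A)
    {ψs : List (Formula L (join x A.ctx))} (h : ∀ ψ ∈ ψs, ψ ∈ p) : BFormula.bigConj ψs ∈ p := by
  obtain ⟨N, f, c, hf, rfl⟩ := exists_eq_phiTypeOf hp
  exact ⟨.bigConj fun ψ hψ => (h ψ hψ).1, (N.sat_bigConj _ _).2 fun ψ hψ => (h ψ hψ).2⟩

theorem pow_mem_phiType_iff {p : Set (Formula L (join x A.ctx))} (hp : p ∈ phiTypes φ M A)
    {ψ : Formula L (join x A.ctx)} (hψ : IsPhiFormula φ A ψ) (t : Bool) :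
    ψ.pow t ∈ p ↔ (ψ ∈ p ↔ t = true) := by
  cases t
  · simp [BFormula.pow, neg_mem_phiType_iff hp hψ]
  · simp [BFormula.pow]

theorem phiTypes_ext {p q : Set (Formula L (join x A.ctx))} (hp : p ∈ phiTypes φ M A)
    (hq : q ∈ phiTypes φ M A) (h : ∀ a : Tuple y A.ctx, φ.inst a ∈ p ↔ φ.inst a ∈ q) : p = q := by
  have key : ∀ ψ, IsPhiFormula φ A ψ → (ψ ∈ p ↔ ψ ∈ q) := by
    intro ψ hψ
    induction hψ with
    | inst a => exact h a
    | falsum => simp [falsum_notMem_phiType hp, falsum_notMem_phiType hq]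
    | imp h₁ h₂ ih₁ ih₂ =>
      rw [imp_mem_phiType_iff hp h₁ h₂, imp_mem_phiType_iff hq h₁ h₂, ih₁, ih₂]
  ext ψ
  exact ⟨fun h => (key ψ (isPhiFormula_of_mem hp h)).1 h,
    fun h => (key ψ (isPhiFormula_of_mem hq h)).2 h⟩

/-- A set of `φ`-formulas whose finite conjunctions are wide extends to a wide complete `φ`-type. -/
theorem exists_widePhiType {I : Preschema L x} {T : Set (Sentence L)} (hI : I.IsIdealSchema T)
    (hM : M.Models T) {Γ : Set (Formula L (join x A.ctx))} (hΓ : ∀ ψ ∈ Γ, IsPhiFormula φ A ψ)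
    (h : ∀ F : Finset (Formula L (join x A.ctx)), ↑F ⊆ Γ →
      M.points (BFormula.bigConj F.toList) A.incl ∉ I.idealPoints M) :
    ∃ p ∈ widePhiTypes I φ M A, Γ ⊆ p := by
  classical
  obtain ⟨-, hJ⟩ := hI M hM
  let S : Set (Set (Tuple x M.carrier)) :=
    (fun ψ => M.points ψ A.incl) '' Γ ∪ {D | Dᶜ ∈ I.idealPoints M}
  have hS : (Filter.generate S).NeBot := by
    rw [Filter.generate_neBot_iff]
    intro t htS ht
    -- Every finite intersection contains a wide set minus a small set, hence is nonempty.
    have key : ∃ F : Finset (Formula L (join x A.ctx)), ↑F ⊆ Γ ∧ ∃ E ∈ I.idealPoints M,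
        M.points (BFormula.bigConj F.toList) A.incl \ E ⊆ ⋂₀ t := by
      induction t, ht using Set.Finite.induction_on with
      | empty => exact ⟨∅, by simp, ∅, hJ.empty_mem, by simp⟩
      | @insert D t _ _ ih =>
        obtain ⟨F, hF, E, hE, hFE⟩ := ih ((Set.subset_insert _ _).trans htS)
        rw [Set.sInter_insert]
        rcases htS (Set.mem_insert _ _) with ⟨ψ, hψ, rfl⟩ | hD
        · refine ⟨insert ψ F, ?_, E, hE, ?_⟩
          · rw [Finset.coe_insert]
            exact Set.insert_subset hψ hF
          · rintro a ⟨ha, haE⟩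
            simp only [Struct.points, Set.mem_ofPred_eq, Struct.sat_bigConj, Finset.mem_toList,
              Finset.forall_mem_insert] at ha
            refine ⟨ha.1, hFE ⟨?_, haE⟩⟩
            simpa only [Struct.points, Set.mem_ofPred_eq, Struct.sat_bigConj, Finset.mem_toList]
              using ha.2
        · refine ⟨F, hF, E ∪ Dᶜ, hJ.union_mem _ hE _ hD, ?_⟩
          rintro a ⟨ha, haE⟩
          rw [Set.mem_union, not_or] at haE
          exact ⟨not_not.1 haE.2, hFE ⟨ha, haE.1⟩⟩
    obtain ⟨F, hF, E, hE, hFE⟩ := key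
    by_contra hne
    rw [Set.not_nonempty_iff_eq_empty] at hne
    rw [hne, Set.subset_empty_iff, Set.sdiff_eq_empty] at hFE
    exact h F hF (hJ.mem_of_subset E hE _ (M.points_mem_Def _ _) hFE)
  let U : Ultrafilter (Tuple x M.carrier) := Ultrafilter.of (Filter.generate S)
  have hU : ∀ D ∈ S, D ∈ U := fun D hD =>
    Ultrafilter.of_le (Filter.generate S) (Filter.mem_generate_of_mem hD)
  -- In the ultrapower over the index set `M_x`, the class of the identity satisfies exactly the
  -- formulas whose sets lie in `U`. As `U` contains the complements of small sets, its `φ`-type is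
  -- wide.
  let N := ultraproduct U fun _ => M
  have hN : ∀ ψ : Formula L (join x A.ctx),
      N.Sat ψ (Tuple.append (ultraMk fun a => a) (ultraMk fun _ => A.incl)) ↔
        M.points ψ A.incl ∈ U := by
    intro ψ
    rw [ultraMk_append]
    exact sat_ultraMk _ ψ
  refine ⟨phiTypeOf φ A N (ultraMk fun _ => A.incl) (ultraMk fun a => a),
    ⟨phiTypeOf_mem_phiTypes (isElementary_diag M A.ctx A.incl) _, ?_⟩, ?_⟩
  · rintro ψ ⟨-, hψ⟩ hn
    have h₁ := hU (M.points ψ A.incl)ᶜ (Or.inr (by simpa using hn))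
    exact Ultrafilter.compl_mem_iff_notMem.1 h₁ ((hN ψ).1 hψ)
  · intro ψ hψ
    exact ⟨hΓ ψ hψ, (hN ψ).2 (hU _ (Or.inl ⟨ψ, hψ, rfl⟩))⟩

end Types

/-! ### Counting definable types -/

section Counting

open Cardinal

theorem Term.relabel_relabel {V W U : L.Sorts → Type u} (g : ∀ s, V s → W s) (h : ∀ s, W s → U s)
    {s : L.Sorts} (t : Term L V s) :
    (t.relabel g).relabel h = t.relabel fun s v => h s (g s v) := by
  induction t with
  | var v => rfl
  | app f ts ih => simp only [Term.relabel, ih]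

theorem BFormula.relabel_relabel {V W U : L.Sorts → Type u} (g : ∀ s, V s → W s)
    (h : ∀ s, W s → U s) {l : List L.Sorts} (ψ : BFormula L V l) :
    (ψ.relabel g).relabel h = ψ.relabel fun s v => h s (g s v) := by
  have e : ∀ l : List L.Sorts, (fun s (v : join V (BVar l) s) =>
      Sum.map (h s) id (Sum.map (g s) id v)) = fun s => Sum.map (fun v => h s (g s v)) id := by
    intro l
    funext s v
    cases v <;> rfl
  induction ψ with
  | falsum => rfl
  | equal t₁ t₂ => simp only [BFormula.relabel, Term.relabel_relabel, e]
  | rel R ts => simp only [BFormula.relabel, Term.relabel_relabel, e]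
  | imp ψ θ ih₁ ih₂ => simp only [BFormula.relabel, ih₁, ih₂]
  | all s ψ ih => simp only [BFormula.relabel, ih]

variable {x y : L.Sorts → Type u} {φ : Formula L (join x y)}

theorem BFormula.inst_relabel {Z W : L.Sorts → Type u} (a : Tuple y Z) (g : ∀ s, Z s → W s) :
    (φ.inst a).relabel (fun s => Sum.map id (g s)) = φ.inst fun s v => g s (a s v) := by
  rw [BFormula.inst, BFormula.relabel_relabel, BFormula.inst]
  congr 1
  funext s v
  cases v <;> rfl

theorem IsPhiFormula.relabel {M N : Struct L} {A : M.Params} {B : N.Params}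
    (g : ∀ s, A.ctx s → B.ctx s) {ψ : Formula L (join x A.ctx)} (h : IsPhiFormula φ A ψ) :
    IsPhiFormula φ B (ψ.relabel fun s => Sum.map id (g s)) := by
  induction h with
  | inst a => rw [BFormula.inst_relabel]; exact .inst _
  | falsum => exact .falsum
  | imp _ _ ih₁ ih₂ => exact .imp ih₁ ih₂

variable {I : Preschema L x} {T : Set (Sentence L)}

/-- An elementary map does not decrease the number of wide complete `φ`-types. -/
theorem mk_widePhiTypes_le_of_elemEq (hI : I.IsIdealSchema T) {M N : Struct L} (hM : M.Models T)
    {A : M.Params} {B : N.Params} (g : ∀ s, A.ctx s → B.ctx s)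
    (hg : ElemEq M A.incl N fun s v => B.incl s (g s v)) :
    #(widePhiTypes I φ M A) ≤ #(widePhiTypes I φ N B) := by
  classical
  have hN := hM.of_elemEq hg
  have key : ∀ p ∈ widePhiTypes I φ M A, ∃ q ∈ widePhiTypes I φ N B,
      (fun ψ => ψ.relabel fun s => Sum.map id (g s)) '' p ⊆ q := by
    intro p hp
    refine exists_widePhiType hI hN ?_ ?_
    · rintro _ ⟨ψ, hψ, rfl⟩
      exact (isPhiFormula_of_mem hp.1 hψ).relabel g
    · intro F hF
      obtain ⟨F, hF', rfl⟩ := Finset.subset_set_image_iff.1 hF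
      have h := hp.2 _ (bigConj_mem_phiType hp.1 (ψs := F.toList) fun ψ hψ =>
        hF' (Finset.mem_toList.1 hψ))
      rw [hI.points_notMem_congr hM _ hg] at h
      convert h using 2
      ext a
      have e := Tuple.append_comp_sumMap (fun _ => id) g a B.incl
      simp only [Struct.points, Set.mem_ofPred_eq, Struct.sat_bigConj, Finset.mem_toList,
        Finset.forall_mem_image, Struct.sat_relabel, e]
      rfl
  choose q hq hpq using key
  refine mk_le_of_injective (f := fun p : widePhiTypes I φ M A =>
    (⟨q p.1 p.2, hq p.1 p.2⟩ : widePhiTypes I φ N B)) ?_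
  -- The extension of `p'` contains the images of the negations of all `φ`-formulas missing from
  -- `p'`, so it determines `p'`.
  have hsub : ∀ (p p' : Set (Formula L (join x A.ctx))) (hp : p ∈ widePhiTypes I φ M A)
      (hp' : p' ∈ widePhiTypes I φ M A), q p hp = q p' hp' → p ⊆ p' := by
    intro p p' hp hp' e ψ hψ
    by_contra hn
    have hφ := isPhiFormula_of_mem hp.1 hψ
    have h₁ := hpq p' hp' ⟨_, (neg_mem_phiType_iff hp'.1 hφ).2 hn, rfl⟩
    refine (neg_mem_phiType_iff (hq p' hp').1 (hφ.relabel g)).1 h₁ ?_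
    rw [← e]
    exact hpq p hp ⟨ψ, hψ, rfl⟩
  rintro ⟨p, hp⟩ ⟨p', hp'⟩ e
  have e' : q p hp = q p' hp' := congrArg Subtype.val e
  exact Subtype.ext ((hsub p p' hp hp' e').antisymm (hsub p' p hp' hp e'.symm))

theorem mk_widePhiTypes_le (hI : I.IsIdealSchema T) (hy : Finite (Σ s, y s))
    (hdef : ∀ N : Struct L, N.Models T → N.OmegaSaturated →
      ∀ p ∈ widePhiTypes I φ N N.allParams, IsDefinableType N p)
    {κ : Cardinal.{u}} (hκ : 2 ^ L.card ≤ κ) {M : Struct L} (hM : M.Models T) {A : M.Params}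
    (hA : A.card ≤ κ) : #(widePhiTypes I φ M A) ≤ κ := by
  have hLκ : L.card ≤ κ := (cantor _).le.trans hκ
  have hω : ℵ₀ ≤ κ := L.aleph0_le_card.trans hLκ
  obtain ⟨N, f, hNs, hf, hNκ⟩ := exists_omegaSaturated M A hκ hA
  have hN := hM.of_elemEq hf
  refine (mk_widePhiTypes_le_of_elemEq hI hM (B := N.allParams)
    (fun s a => ⟨f s a, trivial⟩) hf).trans ?_
  choose d hd using fun p : widePhiTypes I φ N N.allParams => hdef N hN hNs p.1 p.2 y φ
  refine (mk_le_of_injective (f := d) ?_).trans (mk_formula_le hLκ ?_)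
  · have hiff : ∀ (p : widePhiTypes I φ N N.allParams) (a : Tuple y N.allParams.ctx),
        φ.inst a ∈ p.1 ↔
          N.Sat (d p) (Tuple.append (fun s v => (a s v).1) N.allParams.incl) := by
      intro p a
      refine ⟨(hd p a).1, fun h => ?_⟩
      by_contra hn
      exact (hd p a).2 ((neg_mem_phiType_iff p.2.1 (.inst a)).2 hn) h
    intro p p' e
    refine Subtype.ext (phiTypes_ext p.2.1 p'.2.1 fun a => ?_)
    rw [hiff, hiff, e]
  · rw [mk_congr (Equiv.sigmaSumDistrib y N.allParams.ctx), mk_sum, lift_id, lift_id]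
    refine (add_le_add ((lt_aleph0_of_finite _).le.trans hω) (le_trans ?_ hNκ)).trans
      (add_eq_self hω).le
    exact mk_le_of_injective (f := fun m : Σ s, N.allParams.ctx s => ⟨m.1, m.2.1⟩) (by
      rintro ⟨s, m, hm⟩ ⟨s', m', hm'⟩ e
      simp only [Sigma.mk.injEq] at e
      obtain ⟨rfl, e⟩ := e
      rw [heq_eq_eq] at e
      subst e
      rfl)

end Counting

/-! ### Many wide types from a wide tree -/

section ManyTypes

open Cardinal

/-- The increasing enumeration of `K` and the position function. It identifies the finitely many
levels in use with levels of a tree of height `ω`. -/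
theorem exists_nat_enumeration {O : Type u} [LinearOrder O] [Nonempty O] (K : Finset O) :
    ∃ (e : ℕ → O) (r : O → ℕ), ∀ α ∈ K, e (r α) = α ∧ ∀ i < r α, e i < α := by
  classical
  let f := K.orderIsoOfFin rfl
  refine ⟨fun i => if h : i < K.card then f ⟨i, h⟩ else Classical.arbitrary O,
    fun α => if h : α ∈ K then f.symm ⟨α, h⟩ else 0, fun α hα => ⟨?_, fun i hi => ?_⟩⟩
  · simp [hα]
  · simp only [hα, dite_true] at hi
    have hi' : i < K.card := hi.trans (Fin.is_lt _)
    simp only [hi', dite_true]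
    have : (⟨i, hi'⟩ : Fin K.card) < f.symm ⟨α, hα⟩ := hi
    exact (OrderIso.lt_symm_apply f).1 this

variable {x y : L.Sorts → Type u}

/-- The nodes of the full binary tree of height `O`. -/
abbrev Node (O : Type u) [LinearOrder O] : Type u := Σ α : O, (Set.Iio α → Bool)

/-- The node of height `α` on a branch. -/
def node {O : Type u} [LinearOrder O] (σ : O → Bool) (α : O) : Node O := ⟨α, fun β => σ β⟩

/-- The formula `⋀_{α ∈ K} φ(x, y_{σ ↾ α})^{σ(α)}`. -/
noncomputable def branchConj {O : Type u} [LinearOrder O] (φ : Formula L (join x y)) (σ : O → Bool)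
    (K : Finset O) : Formula L (join x fun s => Node O × y s) :=
  BFormula.bigConj (K.toList.map fun α => (φ.inst fun _ v => (node σ α, v)).pow (σ α))

theorem points_branchConj {O : Type u} [LinearOrder O] (φ : Formula L (join x y)) (M : Struct L)
    (b : Tuple (fun s => Node O × y s) M.carrier) (σ : O → Bool) (K : Finset O) :
    M.points (branchConj φ σ K) b =
      {a | ∀ α ∈ K, a ∈ cell φ M (fun s v => b s (node σ α, v)) (σ α)} := by
  ext a
  simp only [branchConj, Struct.points, Set.mem_ofPred_eq, Struct.sat_bigConj, List.mem_map,
    Finset.mem_toList, forall_exists_index, and_imp, forall_apply_eq_imp_iff₂, Struct.sat_pow,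
    Struct.sat_inst, cell]

variable {φ : Formula L (join x y)} {I : Preschema L x} {T : Set (Sentence L)}

/-- By compactness finitely many levels suffice. A node of level `α` is then sent to the finite
binary sequence of its values at the levels enumerated before `α`. -/
theorem exists_wide_tree (hI : I.IsIdealSchema T) (h : ConsistentWith T (Tree I φ)) (O : Type u)
    [LinearOrder O] [Nonempty O] :
    ∃ (N : Struct L) (b : Tuple (fun s => Node O × y s) N.carrier), N.Models T ∧
      ∀ (σ : O → Bool) (K : Finset O), N.points (branchConj φ σ K) b ∉ I.idealPoints N := by
  classical
  obtain ⟨M, hM, b, hb⟩ := h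
  rw [hI.sat_tree_iff hM] at hb
  let Γ₀ : Set (Formula L fun s => Node O × y s) :=
    {θ | ∃ (σ : O → Bool) (K : Finset O), θ ∈ I.notI (branchConj φ σ K)}
  let Γ : Set (Formula L (join (fun s => Node O × y s) fun _ => PEmpty)) :=
    (fun θ => θ.relabel fun _ => Sum.inl) '' Γ₀
  obtain ⟨N, d, hd, b', hb'⟩ := exists_realizing M Γ (fun _ v => nomatch v) (by
    intro F hF
    obtain ⟨F, hF', rfl⟩ := Finset.subset_set_image_iff.1 hF
    have hF'' : ∀ θ ∈ F, ∃ (σ : O → Bool) (K : Finset O), θ ∈ I.notI (branchConj φ σ K) :=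
      fun θ h => hF' h
    choose! σ K hK using hF''
    obtain ⟨e, r, her⟩ := exists_nat_enumeration (F.biUnion K)
    -- For levels in the enumerated set the default `false` is never read, because `e i < α`
    -- whenever `i < r α`.
    let c : Tuple (fun s => Node O × y s) M.carrier := fun s v =>
      b s (restr (fun i => if h : e i < v.1.1 then v.1.2 ⟨e i, h⟩ else false) (r v.1.1), v.2)
    refine ⟨c, fun θ' hθ' => ?_⟩
    obtain ⟨θ, hθ, rfl⟩ := Finset.mem_image.1 hθ'
    rw [Struct.sat_relabel]
    refine (hI.points_notMem_iff hM (branchConj φ (σ θ) (K θ)) c).1 ?_ θ (hK θ hθ)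
    have hw := hb (fun i => σ θ (e i)) ((K θ).image r)
    convert hw using 2
    rw [points_branchConj]
    ext a
    simp only [Set.mem_ofPred_eq, Finset.forall_mem_image]
    refine forall₂_congr fun α hα => ?_
    obtain ⟨h₁, h₂⟩ := her α (Finset.mem_biUnion.2 ⟨θ, hθ, hα⟩)
    have h₃ : restr (fun i => if h : e i < α then σ θ (e i) else false) (r α) =
        restr (fun i => σ θ (e i)) (r α) := by
      simp only [restr]
      congr 1
      funext i
      simp [h₂ i i.2]
    simp only [c, node, h₁, h₃])
  refine ⟨N, b', hM.of_elemEq hd, fun σ K => ?_⟩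
  rw [hI.points_notMem_iff (hM.of_elemEq hd)]
  intro θ hθ
  have := hb' _ ⟨θ, ⟨σ, K, hθ⟩, rfl⟩
  rwa [Struct.sat_relabel] at this

/-- Two branches share the node at the least level where they differ, so their types disagree on the
instance of `φ` at that node. Well-foundedness supplies this level. -/
theorem mk_bool_fun_le_widePhiTypes (hI : I.IsIdealSchema T) {O : Type u} [LinearOrder O]
    [WellFoundedLT O] {N : Struct L} (hN : N.Models T)
    (b : Tuple (fun s => Node O × y s) N.carrier)
    (hb : ∀ (σ : O → Bool) (K : Finset O), N.points (branchConj φ σ K) b ∉ I.idealPoints N) :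
    #(O → Bool) ≤ #(widePhiTypes I φ N fun s => Set.range (b s)) := by
  classical
  let A : N.Params := fun s => Set.range (b s)
  let a : Node O → Tuple y A.ctx := fun q s v => ⟨b s (q, v), _, rfl⟩
  have key : ∀ σ : O → Bool, ∃ p ∈ widePhiTypes I φ N A,
      (Set.range fun α => (φ.inst (a (node σ α))).pow (σ α)) ⊆ p := by
    intro σ
    refine exists_widePhiType hI hN ?_ ?_
    · rintro _ ⟨α, rfl⟩
      exact (IsPhiFormula.inst _).pow _
    · intro F hF
      rw [← Set.image_univ] at hF
      obtain ⟨K, -, rfl⟩ := Finset.subset_set_image_iff.1 hF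
      convert hb σ K using 2
      rw [points_branchConj]
      ext c
      simp only [Struct.points, Set.mem_ofPred_eq, Struct.sat_bigConj, Finset.mem_toList,
        Finset.forall_mem_image, Struct.sat_pow, Struct.sat_inst, cell]
      rfl
  choose p hp hsub using key
  refine mk_le_of_injective (f := fun σ => (⟨p σ, hp σ⟩ : widePhiTypes I φ N A)) fun σ τ e => ?_
  have e : p σ = p τ := congrArg Subtype.val e
  by_contra hne
  obtain ⟨α, hα, hmin⟩ := WellFounded.has_min (wellFounded_lt (α := O)) {α | σ α ≠ τ α}
    (Function.ne_iff.1 hne)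
  have hnode : node σ α = node τ α := by
    simp only [node]
    congr 1
    funext β
    exact not_not.1 fun h => hmin β h β.2
  have h₁ := hsub σ ⟨α, rfl⟩
  have h₂ := hsub τ ⟨α, rfl⟩
  simp only [] at h₁ h₂
  rw [← e, ← hnode] at h₂
  rw [pow_mem_phiType_iff (hp σ).1 (.inst _)] at h₁ h₂
  exact hα (Bool.eq_iff_iff.2 (h₁.symm.trans h₂))

/-- Take a tree whose height is the least `μ` with `2 ^ μ > κ`: minimality bounds the number of
nodes by `κ`, while there are `2 ^ μ` branches. -/
theorem not_consistentWith_tree (hI : I.IsIdealSchema T) (hy : Finite (Σ s, y s))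
    {κ : Cardinal.{u}} (hκ : ℵ₀ ≤ κ)
    (h : ∀ M : Struct L, M.Models T → ∀ A : M.Params, A.card ≤ κ →
      #(widePhiTypes I φ M A) ≤ κ) : ¬ ConsistentWith T (Tree I φ) := by
  intro hT
  let μ : Cardinal.{u} := sInf {μ | κ < 2 ^ μ}
  have hμ : κ < 2 ^ μ := csInf_mem (s := {μ : Cardinal.{u} | κ < 2 ^ μ}) ⟨κ, cantor κ⟩
  have hμκ : μ ≤ κ := csInf_le' (cantor κ)
  have hlt : ∀ ν < μ, (2 : Cardinal.{u}) ^ ν ≤ κ := fun ν hν =>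
    not_lt.1 fun h' => notMem_of_lt_csInf' hν h'
  have hμ₀ : μ ≠ 0 := by
    intro h₀
    rw [h₀, power_zero] at hμ
    exact absurd hμ (not_lt.2 (one_le_aleph0.trans hκ))
  have : Nonempty μ.ord.ToType := nonempty_ord_toType hμ₀
  obtain ⟨N, b, hN, hb⟩ := exists_wide_tree hI hT μ.ord.ToType
  have h₁ := mk_bool_fun_le_widePhiTypes hI hN b hb
  have h₂ : #(μ.ord.ToType → Bool) = 2 ^ μ := by simp
  -- There are `μ ≤ κ` levels, and the level `α` has `2 ^ ν` nodes for some `ν < μ`, because `μ.ord`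
  -- is an initial ordinal.
  have hnode : #(Node μ.ord.ToType) ≤ κ := by
    refine mk_sigma_le_of_le hκ (by simpa using hμκ) fun α => ?_
    refine le_of_eq_of_le ?_ (hlt _ ((mk_Iio_lt α (by simp)).trans_eq (by simp)))
    simp
  refine absurd (h N hN _ ?_) (not_le.2 (hμ.trans_le (h₂ ▸ h₁)))
  refine (mk_le_of_surjective (f := fun v : Node μ.ord.ToType × Σ s, y s =>
    (⟨v.2.1, b v.2.1 (v.1, v.2.2), _, rfl⟩ : Σ s, (Set.range (b s) : Set _))) ?_).trans ?_
  · rintro ⟨s, _, ⟨q, v⟩, rfl⟩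
    exact ⟨⟨q, s, v⟩, rfl⟩
  · rw [mk_prod, lift_id, lift_id]
    exact (mul_le_mul' hnode ((lt_aleph0_of_finite _).le.trans hκ)).trans (mul_eq_self hκ).le

end ManyTypes

/-! ### Relations definable with parameters -/

section Definable

variable {M : Struct L} {V W : L.Sorts → Type u}

/-- Relations definable in `M` with parameters. -/
def Struct.Definable (M : Struct L) (P : Tuple V M.carrier → Prop) : Prop :=
  ∃ ψ : Formula L (join V M.allParams.ctx), ∀ a, M.Sat ψ (a.append M.allParams.incl) ↔ P a

theorem Struct.Definable.const (p : Prop) : M.Definable fun _ : Tuple V M.carrier => p := by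
  by_cases h : p
  · exact ⟨.verum, fun a => iff_of_true (M.sat_verum _) h⟩
  · exact ⟨.falsum, fun a => iff_of_false (M.sat_falsum _) h⟩

theorem Struct.Definable.imp {P Q : Tuple V M.carrier → Prop} (hP : M.Definable P)
    (hQ : M.Definable Q) : M.Definable fun a => P a → Q a := by
  obtain ⟨ψ, hψ⟩ := hP
  obtain ⟨θ, hθ⟩ := hQ
  exact ⟨.imp ψ θ, fun a => by simp [hψ, hθ]⟩

theorem Struct.Definable.not {P : Tuple V M.carrier → Prop} (hP : M.Definable P) :
    M.Definable fun a => ¬ P a := hP.imp (.const False)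

theorem Struct.Definable.and {P Q : Tuple V M.carrier → Prop} (hP : M.Definable P)
    (hQ : M.Definable Q) : M.Definable fun a => P a ∧ Q a := by
  obtain ⟨ψ, hψ⟩ := hP
  obtain ⟨θ, hθ⟩ := hQ
  exact ⟨ψ.conj θ, fun a => by simp [hψ, hθ]⟩

theorem Struct.Definable.forall_finite {ι : Type*} [Finite ι] {P : ι → Tuple V M.carrier → Prop}
    (hP : ∀ i, M.Definable (P i)) : M.Definable fun a => ∀ i, P i a := by
  have := Fintype.ofFinite ι
  choose ψ hψ using hP
  exact ⟨.bigConj (Finset.univ.toList.map ψ), fun a => by simp [hψ]⟩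

theorem Struct.Definable.comp {P : Tuple V M.carrier → Prop} (hP : M.Definable P)
    (g : ∀ s, V s → W s) : M.Definable fun a : Tuple W M.carrier => P fun s v => a s (g s v) := by
  obtain ⟨ψ, hψ⟩ := hP
  refine ⟨ψ.relabel fun s => Sum.map (g s) id, fun a => ?_⟩
  rw [Struct.sat_relabel, Tuple.append_comp_sumMap (g := fun _ => id)]
  exact hψ _

theorem Struct.Definable.exists {P : Tuple (join V W) M.carrier → Prop} (hP : M.Definable P) :
    M.Definable fun a : Tuple V M.carrier => ∃ b : Tuple W M.carrier, P (a.append b) := by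
  obtain ⟨ψ, hψ⟩ := hP
  obtain ⟨χ, hχ⟩ := exists_quantified (z := W) (V := join V M.allParams.ctx)
    (ψ.relabel fun s v => match v with
      | .inl (.inl v) => .inr (.inl v)
      | .inl (.inr v) => .inl v
      | .inr v => .inr (.inr v))
  refine ⟨χ, fun a => ?_⟩
  rw [hχ]
  refine exists_congr fun b => ?_
  rw [← hψ, Struct.sat_relabel]
  apply iff_of_eq
  congr 1
  funext s v
  rcases v with (v | v) | v <;> rfl

theorem Struct.Definable.eq {s : L.Sorts} (v w : V s) :
    M.Definable fun a : Tuple V M.carrier => a s v = a s w :=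
  ⟨.equal (.var (.inl (.inl v))) (.var (.inl (.inl w))), fun _ => Iff.rfl⟩

variable {A B C : L.Sorts → Type u} {γ : Tuple V M.carrier → ∀ s, A s → C s}
  {η : Tuple V M.carrier → ∀ s, B s → C s}

theorem Term.definable_relabel_eq (h : ∀ s v w, M.Definable fun a => γ a s v = η a s w)
    {s : L.Sorts} (t : Term L A s) (t' : Term L B s) :
    M.Definable fun a => t.relabel (γ a) = t'.relabel (η a) := by
  induction t with
  | var v =>
    cases t' with
    | var w => simpa only [Term.relabel, Term.var.injEq] using h _ v w
    | app f ts => simpa only [Term.relabel, reduceCtorEq] using .const False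
  | @app l s f ts ih =>
    cases t' with
    | var w => simpa only [Term.relabel, reduceCtorEq] using .const False
    | @app l' _ f' ts' =>
      by_cases e : ∃ e : l = l', e ▸ f = f'
      · obtain ⟨rfl, rfl⟩ := e
        simp only [Term.relabel, Term.app.injEq, heq_eq_eq, true_and, funext_iff]
        exact .forall_finite fun i => ih i (ts' i)
      · convert Struct.Definable.const (M := M) (V := V) False using 2 with a
        simp only [Term.relabel, Term.app.injEq, iff_false, not_and]
        rintro rfl hf
        exact absurd ⟨rfl, eq_of_heq hf⟩ e

/-- Two substitution instances coincide when the underlying formulas have the same shape and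
corresponding variables are sent to equal ones, which is a finite conjunction of definable
conditions. -/
theorem BFormula.definable_relabel_eq (h : ∀ s v w, M.Definable fun a => γ a s v = η a s w)
    {l : List L.Sorts} (ψ : BFormula L A l) (θ : BFormula L B l) :
    M.Definable fun a => ψ.relabel (γ a) = θ.relabel (η a) := by
  have hv : ∀ (l : List L.Sorts) s (v : join A (BVar l) s) (w : join B (BVar l) s),
      M.Definable fun a => Sum.map (γ a s) id v = Sum.map (η a s) id w := by
    rintro l s (v | v) (w | w)
    · simpa only [Sum.map_inl, Sum.inl.injEq] using h s v w
    · simpa only [Sum.map_inl, Sum.map_inr, reduceCtorEq] using .const False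
    · simpa only [Sum.map_inl, Sum.map_inr, reduceCtorEq] using .const False
    · simpa only [Sum.map_inr] using .const _
  have ht := fun (l : List L.Sorts) (s : L.Sorts) (t : Term L (join A (BVar l)) s) t' =>
    Term.definable_relabel_eq (hv l) t t'
  induction ψ with
  | falsum =>
    cases θ <;> simp only [BFormula.relabel, reduceCtorEq] <;> exact .const _
  | @equal l s t₁ t₂ =>
    cases θ with
    | @equal _ s' t₁' t₂' =>
      by_cases e : s = s'
      · subst e
        simpa only [BFormula.relabel, BFormula.equal.injEq, heq_eq_eq, true_and] using
          (ht _ _ t₁ t₁').and (ht _ _ t₂ t₂')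
      · simpa only [BFormula.relabel, BFormula.equal.injEq, e, false_and] using .const False
    | _ => simpa only [BFormula.relabel, reduceCtorEq] using .const False
  | @rel l m R ts =>
    cases θ with
    | @rel _ m' R' ts' =>
      by_cases e : ∃ e : m = m', e ▸ R = R'
      · obtain ⟨rfl, rfl⟩ := e
        simp only [BFormula.relabel, BFormula.rel.injEq, heq_eq_eq, true_and, funext_iff]
        exact .forall_finite fun i => ht _ _ (ts i) (ts' i)
      · convert Struct.Definable.const (M := M) (V := V) False using 2 with a
        simp only [BFormula.relabel, BFormula.rel.injEq, iff_false, not_and]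
        rintro rfl hf
        exact absurd ⟨rfl, eq_of_heq hf⟩ e
    | _ => simpa only [BFormula.relabel, reduceCtorEq] using .const False
  | imp ψ₁ ψ₂ ih₁ ih₂ =>
    cases θ with
    | imp θ₁ θ₂ =>
      simpa only [BFormula.relabel, BFormula.imp.injEq] using (ih₁ θ₁).and (ih₂ θ₂)
    | _ => simpa only [BFormula.relabel, reduceCtorEq] using .const False
  | all s ψ ih =>
    cases θ with
    | all s' θ =>
      by_cases e : s = s'
      · subst e
        simpa only [BFormula.relabel, BFormula.all.injEq, heq_eq_eq, true_and] using ih θ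
      · simpa only [BFormula.relabel, BFormula.all.injEq, e, false_and] using .const False
    | _ => simpa only [BFormula.relabel, reduceCtorEq] using .const False

end Definable

/-! ### Definability of wide types -/

section DefinableTypes

variable {x y z : L.Sorts → Type u} {M : Struct L} {φ : Formula L (join x y)}

/-- A tuple of `M`, as a tuple of parameters. -/
def Tuple.toParams (c : Tuple z M.carrier) : Tuple z M.allParams.ctx := fun s v => ⟨c s v, trivial⟩

theorem definable_inst_eq (χ : Formula L (join x z)) (φ : Formula L (join x y)) :
    M.Definable fun c : Tuple (join z y) M.carrier =>
      χ.inst (Tuple.toParams fun s v => c s (.inl v)) =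
        φ.inst (Tuple.toParams fun s v => c s (.inr v)) := by
  refine BFormula.definable_relabel_eq (V := join z y) (C := join x M.allParams.ctx)
    (γ := fun c s => Sum.map id fun v => ⟨c s (Sum.inl v), trivial⟩)
    (η := fun c s => Sum.map id fun v => ⟨c s (Sum.inr v), trivial⟩) ?_ χ φ
  rintro s (v | v) (w | w)
  · simpa only [Sum.map_inl] using .const _
  · simpa only [Sum.map_inl, Sum.map_inr, reduceCtorEq] using .const False
  · simpa only [Sum.map_inl, Sum.map_inr, reduceCtorEq] using .const False
  · obtain ⟨ψ, hψ⟩ := Struct.Definable.eq (M := M) (V := join z y) (.inl v) (.inr w)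
    refine ⟨ψ, fun c => (hψ c).trans ?_⟩
    exact ⟨fun h => congrArg Sum.inr (Subtype.ext h),
      fun h => congrArg Subtype.val (Sum.inr.inj h)⟩

/-- Members of `p` are literally Boolean combinations of instances of `φ`. By induction on `χ`,
whenever `χ(x, c)` is a `φ`-formula it is an instance `φ(x, a)`, a definable condition by
`definable_inst_eq`, or it is `⊥`, or it is an implication between smaller `φ`-formulas. -/
theorem isDefinableType_of_definable {p : Set (Formula L (join x M.allParams.ctx))}
    (hp : p ∈ phiTypes φ M M.allParams)
    (h : M.Definable fun c : Tuple y M.carrier => φ.inst c.toParams ∈ p) :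
    IsDefinableType M p := by
  intro z χ
  have hE : ∀ χ : Formula L (join x z), M.Definable fun c : Tuple z M.carrier =>
      ∃ a : Tuple y M.carrier, χ.inst c.toParams = φ.inst a.toParams :=
    fun χ => (definable_inst_eq χ φ).exists
  have hP : ∀ χ : Formula L (join x z), M.Definable fun c : Tuple z M.carrier =>
      ∃ a : Tuple y M.carrier, χ.inst c.toParams = φ.inst a.toParams ∧ φ.inst a.toParams ∈ p :=
    fun χ => ((definable_inst_eq χ φ).and
      (h.comp (W := join z y) fun _ => Sum.inr)).exists
  have hEP : ∀ (χ : Formula L (join x z)) (c : Tuple z M.carrier),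
      (∃ a : Tuple y M.carrier, χ.inst c.toParams = φ.inst a.toParams) →
      ((∃ a : Tuple y M.carrier, χ.inst c.toParams = φ.inst a.toParams ∧ φ.inst a.toParams ∈ p) ↔
        χ.inst c.toParams ∈ p) := by
    rintro χ c ⟨a, ha⟩
    exact ⟨fun ⟨a, ha, h⟩ => ha ▸ h, fun h => ⟨a, ha, ha ▸ h⟩⟩
  -- The list of bound variables is generalized so that induction on `χ` is possible; `hl` returns
  -- to the quantifier-free-context case.
  have key : ∀ {l : List L.Sorts} (χ : BFormula L (join x z) l) (hl : l = []),
      ∃ P : Tuple z M.carrier → Prop, M.Definable P ∧ ∀ c : Tuple z M.carrier,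
        IsPhiFormula φ M.allParams (BFormula.inst (hl ▸ χ : BFormula L (join x z) []) c.toParams) →
          (P c ↔ BFormula.inst (hl ▸ χ : BFormula L (join x z) []) c.toParams ∈ p) := by
    intro l χ hl
    induction χ with
    | @falsum l =>
      subst hl
      exact ⟨_, .const False, fun c _ => iff_of_false id (falsum_notMem_phiType hp)⟩
    | @equal l s t₁ t₂ =>
      subst hl
      refine ⟨_, hP (.equal t₁ t₂), fun c hc => hEP (.equal t₁ t₂) c ?_⟩
      generalize e : BFormula.inst _ c.toParams = ζ at hc
      cases hc with
      | inst a => exact ⟨fun s v => (a s v).1, rfl⟩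
      | _ => cases e
    | @rel l m R ts =>
      subst hl
      refine ⟨_, hP (.rel R ts), fun c hc => hEP (.rel R ts) c ?_⟩
      generalize e : BFormula.inst _ c.toParams = ζ at hc
      cases hc with
      | inst a => exact ⟨fun s v => (a s v).1, rfl⟩
      | _ => cases e
    | @all l s ψ ih =>
      subst hl
      refine ⟨_, hP (.all s ψ), fun c hc => hEP (.all s ψ) c ?_⟩
      generalize e : BFormula.inst _ c.toParams = ζ at hc
      cases hc with
      | inst a => exact ⟨fun s v => (a s v).1, rfl⟩
      | _ => cases e
    | @imp l ψ θ ih₁ ih₂ =>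
      subst hl
      obtain ⟨P, hPd, hPc⟩ := ih₁ rfl
      obtain ⟨Q, hQd, hQc⟩ := ih₂ rfl
      -- When `φ` is itself an implication, `χ(x, c)` can be an instance of `φ` without its two
      -- sides being `φ`-formulas, so this case is decided first.
      refine ⟨_, ((hE (.imp ψ θ)).imp (hP (.imp ψ θ))).and ((hE (.imp ψ θ)).not.imp (hPd.imp hQd)),
        fun c hc => ?_⟩
      by_cases hex : ∃ a : Tuple y M.carrier, BFormula.inst (.imp ψ θ) c.toParams =
          φ.inst a.toParams
      · have := hEP (.imp ψ θ) c hex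
        simp only [hex, true_imp_iff, not_true_eq_false, false_imp_iff, and_true]
        exact this
      · simp only [hex, false_imp_iff, true_and, not_false_eq_true, true_imp_iff]
        generalize e : BFormula.inst _ c.toParams = ζ at hc
        cases hc with
        | inst a => exact absurd ⟨fun s v => (a s v).1, e⟩ hex
        | falsum => cases e
        | imp h₁ h₂ =>
          obtain ⟨rfl, rfl⟩ := BFormula.imp.inj e
          rw [imp_mem_phiType_iff hp h₁ h₂]
          exact imp_congr (hPc c h₁) (hQc c h₂)
  -- Working with `¬χ` covers both requirements: if `χ(x, c)` is a `φ`-formula then so is its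
  -- negation, but the converse fails when `φ` is itself a negation.
  obtain ⟨P, hPd, hPc⟩ := key χ.neg rfl
  obtain ⟨ψ, hψ⟩ := hPd.not
  refine ⟨ψ, fun c => ⟨fun hc => ?_, fun hc => ?_⟩⟩
  · have hφ := isPhiFormula_of_mem hp hc
    exact (hψ _).2 fun h => (neg_mem_phiType_iff hp hφ).1 ((hPc (fun s v => (c s v).1) hφ.neg).1 h) hc
  · exact fun h => (hψ _).1 h ((hPc (fun s v => (c s v).1) (isPhiFormula_of_mem hp hc)).2 hc)

/-- In an `ω`-saturated structure, disjoint type-definable sets are separated by a formula. -/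
theorem Struct.OmegaSaturated.exists_separating (hM : M.OmegaSaturated) (A : M.Params)
    (hA : Finite (Σ s, A s)) (hy : Finite (Σ s, y s)) (z : Bool → L.Sorts → Type u)
    (hz : ∀ t, Finite (Σ s, z t s)) (Γ : ∀ t, Set (Formula L (join (z t) (join A.ctx y))))
    (h : ∀ c : Tuple y M.carrier, ¬ ∀ t, ∃ b : Tuple (z t) M.carrier,
      ∀ θ ∈ Γ t, M.Sat θ (b.append (A.incl.append c))) :
    ∃ δ : Formula L (join A.ctx y), ∀ c : Tuple y M.carrier,
      ((∃ b : Tuple (z true) M.carrier, ∀ θ ∈ Γ true, M.Sat θ (b.append (A.incl.append c))) →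
        M.Sat δ (A.incl.append c)) ∧
      ((∃ b : Tuple (z false) M.carrier, ∀ θ ∈ Γ false, M.Sat θ (b.append (A.incl.append c))) →
        ¬ M.Sat δ (A.incl.append c)) := by
  classical
  let r : (Σ t, Formula L (join (z t) (join A.ctx y))) → Formula L (join (splitVars y z) A.ctx) :=
    fun q => q.2.relabel (splitRename y z A.ctx q.1)
  -- A realization of both types with a common `c` would contradict disjointness, so already a
  -- finite part of their union is unsatisfiable.
  have hn : ¬ FinSat M (r '' {q | q.2 ∈ Γ q.1}) A.incl := by
    intro hfin
    obtain ⟨c, hc⟩ := hM A hA _ (finite_splitVars hy hz) _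
      ((M.isPartialType_iff_finSat A _).2 hfin)
    refine h (fun s v => c s (.inl v)) fun t => ⟨fun s v => c s (.inr ⟨t, v⟩), fun θ hθ => ?_⟩
    have := hc _ ⟨⟨t, θ⟩, hθ, rfl⟩
    rwa [Struct.sat_relabel, append_comp_splitRename] at this
  rw [FinSat] at hn
  push Not at hn
  obtain ⟨F, hF, hn⟩ := hn
  obtain ⟨G, hG, rfl⟩ := Finset.subset_set_image_iff.1 hF
  let F' : ∀ t, Finset (Formula L (join (z t) (join A.ctx y))) := fun t =>
    G.preimage (fun θ => ⟨t, θ⟩) fun _ _ _ _ h => by simpa using h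
  have hF' : ∀ t, ∀ θ ∈ F' t, θ ∈ Γ t := fun t θ hθ => hG (Finset.mem_preimage.1 hθ)
  -- The separating formula says that the finite part belonging to `true` has a witness; the part
  -- belonging to `false` then excludes it.
  obtain ⟨δ, hδ⟩ := exists_quantified_finset (F' true)
  refine ⟨δ, fun c => ⟨fun ⟨b, hb⟩ => (hδ _ _).2 ⟨b, fun θ hθ => hb θ (hF' _ θ hθ)⟩, ?_⟩⟩
  rintro ⟨b₀, hb₀⟩ hc
  obtain ⟨b₁, hb₁⟩ := (hδ _ _).1 hc
  let b : ∀ t, Tuple (z t) M.carrier := fun t => t.casesOn b₀ b₁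
  have hb : ∀ t, ∀ θ ∈ F' t, M.Sat θ ((b t).append (A.incl.append c)) := by
    rintro (_ | _) θ hθ
    · exact hb₀ θ (hF' _ θ hθ)
    · exact hb₁ θ hθ
  obtain ⟨θ', hθ', hn'⟩ := hn fun s => Sum.elim (c s) fun v => b v.1 s v.2
  obtain ⟨⟨t, θ⟩, hθ, rfl⟩ := Finset.mem_image.1 hθ'
  refine hn' ?_
  rw [Struct.sat_relabel, append_comp_splitRename]
  exact hb t θ (Finset.mem_preimage.2 hθ)

variable {I : Preschema L x} {T : Set (Sentence L)}

theorem exists_finite_params (ψ : Formula L (join x M.allParams.ctx)) :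
    ∃ (A : M.Params) (ψ' : Formula L (join x A.ctx)), Finite (Σ s, A s) ∧
      M.points ψ' A.incl = M.points ψ M.allParams.incl := by
  let S : Set (Σ s, M.carrier s) := {m | (⟨m.1, .inr ⟨m.2, trivial⟩⟩ :
    Σ s, join x M.allParams.ctx s) ∈ ψ.fv}
  have hS : S.Finite := by
    refine ψ.finite_fv.preimage ?_
    rintro ⟨s, v⟩ - ⟨s', v'⟩ - h
    simp only [Sigma.mk.injEq] at h
    obtain ⟨rfl, h⟩ := h
    exact congrArg (Sigma.mk s) (congrArg Subtype.val (Sum.inr.inj (eq_of_heq h)))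
  obtain ⟨ψ', hψ⟩ := BFormula.exists_relabel_eq (U := join x fun s => (paramsOf S s : Type u))
    (fun s => Sum.map id fun m => (⟨m.1, trivial⟩ : M.allParams.ctx s)) ψ (by
      rintro ⟨s, v | v⟩ hv
      · exact ⟨.inl v, rfl⟩
      · exact ⟨.inr ⟨v.1, hv⟩, rfl⟩)
  refine ⟨paramsOf S, ψ', finite_subtype_context hS, ?_⟩
  rw [← hψ, Struct.points_relabel]
  rfl

/-- A formula `ψ ∈ p` of least rank `n` cannot split into two halves of rank at least `n`, whereas
every conjunction inside `p` has rank at least `n`. Hence `p` selects the half of full rank. -/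
theorem isDefinableType_of_rank (hI : I.IsIdealSchema T) (hy : Finite (Σ s, y s))
    (hM : M.Models T) (hMs : M.OmegaSaturated) (hr : ¬ ∀ n, WideRankGE I φ M n Set.univ)
    {p : Set (Formula L (join x M.allParams.ctx))} (hp : p ∈ widePhiTypes I φ M M.allParams) :
    IsDefinableType M p := by
  classical
  have hverum : BFormula.verum ∈ p :=
    (neg_mem_phiType_iff hp.1 .falsum).2 (falsum_notMem_phiType hp.1)
  have hex : ∃ n, ∃ ψ ∈ p, ¬ WideRankGE I φ M n (M.points ψ M.allParams.incl) := by
    rw [not_forall] at hr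
    obtain ⟨n, hn⟩ := hr
    exact ⟨n, _, hverum, by rwa [points_verum]⟩
  -- The first failing bound is not `0` because `p` is wide.
  obtain ⟨n, hn⟩ : ∃ n, Nat.find hex = n + 1 := by
    refine Nat.exists_eq_succ_of_ne_zero fun h₀ => ?_
    obtain ⟨ψ, hψ, hn⟩ := Nat.find_spec hex
    rw [h₀] at hn
    exact hn (hp.2 ψ hψ)
  obtain ⟨ψ, hψ, hψn⟩ := Nat.find_spec hex
  have hmin : ∀ ψ ∈ p, WideRankGE I φ M n (M.points ψ M.allParams.incl) := by
    intro ψ hψ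
    by_contra h
    exact Nat.find_min hex (m := n) (by omega) ⟨ψ, hψ, h⟩
  rw [hn] at hψn
  -- Saturation concerns finite parameter sets, so `ψ` is rewritten over the parameters it uses.
  obtain ⟨A, ψ', hA, hψ'⟩ := exists_finite_params ψ
  choose z Γ hz hΓ using fun t : Bool =>
    wideRankGE_typeDefinable hI hy φ n (join A.ctx y) (splitFormula ψ' φ t)
  have hΓ' : ∀ (c : Tuple y M.carrier) (t : Bool),
      (∃ b : Tuple (z t) M.carrier, ∀ θ ∈ Γ t, M.Sat θ (b.append (A.incl.append c))) ↔
        WideRankGE I φ M n (M.points ψ M.allParams.incl ∩ cell φ M c t) := by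
    intro c t
    rw [← hΓ t M hM, points_splitFormula, hψ']
  obtain ⟨δ, hδ⟩ := hMs.exists_separating A hA hy z hz Γ (by
    intro c h
    exact hψn ⟨c, fun t => (hΓ' c t).1 (h t)⟩)
  have hcell : ∀ (c : Tuple y M.carrier) (t : Bool), (φ.inst c.toParams).pow t ∈ p →
      WideRankGE I φ M n (M.points ψ M.allParams.incl ∩ cell φ M c t) := by
    intro c t h
    have := hmin _ (conj_mem_phiType hp.1 hψ h)
    rwa [Struct.points_conj, Struct.points_inst_pow] at this
  refine isDefinableType_of_definable hp.1
    ⟨δ.relabel fun s => Sum.elim (fun a => .inr ⟨a.1, trivial⟩) .inl, fun c => ?_⟩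
  have hsat : M.Sat (δ.relabel fun s => Sum.elim (fun a : A.ctx s =>
      (.inr ⟨a.1, trivial⟩ : join y M.allParams.ctx s)) .inl) (c.append M.allParams.incl) ↔
      M.Sat δ (A.incl.append c) := by
    rw [Struct.sat_relabel]
    apply iff_of_eq
    congr 1
    funext s v
    cases v <;> rfl
  rw [hsat]
  constructor
  · intro h
    by_contra hc
    exact (hδ c).2 ((hΓ' c false).2 (hcell c false ((neg_mem_phiType_iff hp.1 (.inst _)).2 hc))) h
  · intro h
    exact (hδ c).1 ((hΓ' c true).2 (hcell c true h))

end DefinableTypes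

end ManySorted

/-! ### The equivalence -/

theorem mainTheorem1 (L : ManySorted.Language.{u}) (T : Set (ManySorted.Sentence L))
    (hT : ManySorted.IsComplete T) (x y : L.Sorts → Type u) [Finite (Σ s, y s)]
    (I : ManySorted.Preschema L x) (hI : I.IsIdealSchema T)
    (φ : ManySorted.Formula L (ManySorted.join x y)) :
    List.TFAE [
      -- (a) for every `λ ≥ 2 ^ |L|`
      ∀ lam : Cardinal.{u}, 2 ^ L.card ≤ lam →
        ∀ M : ManySorted.Struct L, M.Models T → ∀ A : M.Params, A.card ≤ lam →
          Cardinal.mk (ManySorted.widePhiTypes I φ M A) ≤ lam,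
      -- (b) for some `λ ≥ ℵ₀`
      ∃ lam : Cardinal.{u}, Cardinal.aleph0 ≤ lam ∧
        ∀ M : ManySorted.Struct L, M.Models T → ∀ A : M.Params, A.card ≤ lam →
          Cardinal.mk (ManySorted.widePhiTypes I φ M A) ≤ lam,
      -- (c) the tree is inconsistent with `T`
      ¬ ManySorted.ConsistentWith T (ManySorted.Tree I φ),
      -- (d) the rank of `T`, computed in any `ω`-saturated model, is not `+∞`
      ∀ M : ManySorted.Struct L, M.Models T → M.OmegaSaturated →
        ManySorted.rank I φ M .verum < ⊤,
      -- (d) again, computed in some `ω`-saturated model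
      ∃ M : ManySorted.Struct L, M.Models T ∧ M.OmegaSaturated ∧
        ManySorted.rank I φ M .verum < ⊤,
      -- (e) wide `φ`-types over `ω`-saturated models are definable
      ∀ M : ManySorted.Struct L, M.Models T → M.OmegaSaturated →
        ∀ p ∈ ManySorted.widePhiTypes I φ M M.allParams, ManySorted.IsDefinableType M p] := by
  have hy : Finite (Σ s, y s) := inferInstance
  tfae_have 1 → 2 := fun h =>
    ⟨2 ^ L.card, L.aleph0_le_card.trans (Cardinal.cantor _).le, h _ le_rfl⟩
  tfae_have 2 → 3 := fun ⟨_, hκ, h⟩ => ManySorted.not_consistentWith_tree hI hy hκ h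
  tfae_have 3 → 4 := fun h M hM _ => (ManySorted.rank_lt_top_iff I φ M).2 fun hr =>
    h (ManySorted.consistentWith_tree hI hM hr)
  tfae_have 4 → 5 := by
    intro h
    obtain ⟨M, hM⟩ := hT.prop
    obtain ⟨N, f, hN, hMN, -⟩ := ManySorted.exists_omegaSaturated M (fun _ => ∅)
      (κ := 2 ^ L.card) le_rfl (by simp [ManySorted.Struct.Params.card])
    have hNT := ManySorted.Struct.Models.of_elemEq hM hMN
    exact ⟨N, hNT, hN, h N hNT hN⟩
  -- A tree in any model forces infinite rank in the given `ω`-saturated one, so the choice of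
  -- saturated model in (d) is immaterial.
  tfae_have 5 → 3 := by
    rintro ⟨M, hM, hMs, hr⟩ ⟨N, hN, b, hb⟩
    exact (ManySorted.rank_lt_top_iff I φ M).1 hr fun n =>
      (ManySorted.WideRankGE.of_tree hI hN hb n).transfer hT hI hy hN hM hMs
  tfae_have 4 → 6 := fun h M hM hMs p hp => ManySorted.isDefinableType_of_rank hI hy hM hMs
    ((ManySorted.rank_lt_top_iff I φ M).1 (h M hM hMs)) hp
  tfae_have 6 → 1 := fun h κ hκ M hM A hA => ManySorted.mk_widePhiTypes_le hI hy h hκ hM hA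
  tfae_finish
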